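/- Let $P\subset\mathbb E^d$ be a $d$-dimensional convex polytope, and let $\mathcal T_P$ be a normal (face-to-face) tiling of $\mathbb E^d$ by translates of $P$, so that $P$ is a parallelohedron. Let $s$ be a translation-invariant canonical scaling of $\mathcal T_P$. That is, $s$ is a positive function on the $(d-1)$-faces (facets) of the tiling such that * $s(F+v)=s(F)$ for every facet $F$ and every translation $v$ preserving $\mathcal T_P$, and * for every $(d-2)$-face $R$ of the tiling, $\sum_i s(F_i)\mathbf n_i=0$, where $F_1,\dots,F_k$ are all facets of the tiling containing $R$ and $\mathbf n_i$ are their unit normals chosen consistently with one direction of going around $R$. Fix a tile $P_0$. The generatrix $\mathcal G_P\subset\mathbb E^d\times\mathbb R$ is the union of the lifts of tiles obtained along all chains of tiles, consecutive ones sharing a facet, that start at $P_0$. Here $P_0$ is lifted to $P_0\times\{0\}$, with normal $(\mathbf 0,-1)$. If $P_j$ shares a facet with $P_i$, and $\widetilde P_i$ is a lift of $P_i$ with normal $(\mathbf v,-1)$, then $P_j$ is lifted to the polytope $\widetilde P_j$ that projects onto $P_j$, has normal $(\mathbf v+s(P_i\cap P_j)\,\mathbf n_{i,j},-1)$, and meets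 $\widetilde P_i$ in a set projecting onto $P_i\cap P_j$; here $\mathbf n_{i,j}$ is the unit normal to $P_i\cap P_j$ directed from $P_i$ to $P_j$. Then every tile has a centre of symmetry, $\mathcal G_P$ is the graph of a function $G:\mathbb E^d\to\mathbb R$, and there is a positive definite symmetric matrix $Q$ with the following properties, where $c$ is the centre of $P_0$ and $Q(x)=\tfrac12x^{T}Qx$: 1. For every tile $A$ sharing a facet with $P_0$, with centre $a$, one has $s(P_0\cap A)\,\mathbf n=Q(a-c)$, where $\mathbf n$ is the unit normal to $P_0\cap A$ directed from $P_0$ to $A$. 2. The elliptic paraboloid $\Pi_P=\{(x,Q(x-c)) : x\in\mathbb E^d\}$ is inscribed in $\mathcal G_P$: $G(x)\le Q(x-c)$ for all $x$. 3. $G(x)=Q(x-c)$ if and only if $x$ is the centre of a tile. 4. Above the centre $x$ of every tile the two surfaces are tangent: $G$ and $y\mapsto Q(y-c)$ are differentiable at $x$ with the common gradient $Q\cdot(x-c)$. -/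

import Mathlib

open scoped InnerProductSpace Pointwise

noncomputable section

namespace ParTiling

/-- The Euclidean space of dimension `d`. -/
abbrev E (d : ℕ) : Type := EuclideanSpace ℝ (Fin d)

variable {d : ℕ}

/-- A `d`-dimensional convex polytope in `E d`. -/
def IsFullPolytope (P : Set (E d)) : Prop :=
  (∃ V : Set (E d), V.Finite ∧ P = convexHull ℝ V) ∧ (interior P).Nonempty

/-- `T` is a normal (face-to-face) tiling of the space by translates of the polytope `P`, so that
`P` is a parallelohedron. The empty set and the polytope itself count as faces here. -/
structure IsParallelohedralTiling (P : Set (E d)) (T : Set (Set (E d))) : Prop where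
  polytope : IsFullPolytope P
  translates : ∀ A ∈ T, ∃ v : E d, A = v +ᵥ P
  covers : ⋃₀ T = Set.univ
  face_to_face : ∀ A ∈ T, ∀ B ∈ T, IsExposed ℝ A (A ∩ B) ∧ IsExposed ℝ B (A ∩ B)

/-- Dimension of (the affine hull of) a nonempty set. -/
def dim (F : Set (E d)) : ℕ := Module.finrank ℝ (vectorSpan ℝ F)

/-- `F` is a nonempty face of some tile of `T`. -/
def IsFaceOf (T : Set (Set (E d))) (F : Set (E d)) : Prop :=
  F.Nonempty ∧ ∃ A ∈ T, IsExposed ℝ A F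

/-- `(d-1)`-dimensional faces of the tiling. -/
def IsFacet (T : Set (Set (E d))) (F : Set (E d)) : Prop := IsFaceOf T F ∧ dim F + 1 = d

/-- `(d-2)`-dimensional faces of the tiling. -/
def IsRidge (T : Set (Set (E d))) (R : Set (E d)) : Prop := IsFaceOf T R ∧ dim R + 2 = d

/-- The linear subspace orthogonal to `R`; it is two-dimensional if `R` is a ridge. -/
abbrev normalSpace (R : Set (E d)) : Submodule ℝ (E d) := (vectorSpan ℝ R)ᗮ

/-- `u` is the unit vector, orthogonal to the ridge `R`, along which the facet `F` containing `R`
leaves `R`: the projection of `F` to the plane orthogonal to `R` lies on the ray from the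
projection of `R` in the direction `u`. -/
def IsRayDirection (R F : Set (E d)) (u : normalSpace R) : Prop :=
  ‖u‖ = 1 ∧ (u : E d) ∈ vectorSpan ℝ F ∧ ∀ x ∈ F, ∀ r ∈ R, 0 ≤ ⟪(u : E d), x - r⟫_ℝ

/-- The torsion of `s` around the ridge `R`: the sum of `s F • n F` over all facets `F` of the
tiling that contain `R`, where `n F` are unit normals that agree with one direction of traversal
around `R`. The direction of traversal is a quarter turn `J` of the plane orthogonal to `R`, and
`n F = J (u F)`, where `u F` is the direction in which `F` leaves `R`. -/
def torsion (T : Set (Set (E d))) (s : Set (E d) → ℝ) (R : Set (E d))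
    (J : normalSpace R →ₗᵢ[ℝ] normalSpace R) (u : Set (E d) → normalSpace R) : E d :=
  ∑ᶠ F ∈ {F : Set (E d) | IsFacet T F ∧ R ⊆ F}, s F • ((J (u F) : normalSpace R) : E d)

/-- A canonical scaling: positive on the facets, with zero torsion around every ridge (for both
directions of traversal `J`). Only the values of `s` on facets of `T` matter. -/
structure IsCanonicalScaling (T : Set (Set (E d))) (s : Set (E d) → ℝ) : Prop where
  pos : ∀ F, IsFacet T F → 0 < s F
  torsion_eq_zero : ∀ R, IsRidge T R →
    ∀ J : normalSpace R →ₗᵢ[ℝ] normalSpace R, (∀ w, ⟪J w, w⟫_ℝ = 0) →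
    ∀ u : Set (E d) → normalSpace R,
      (∀ F, IsFacet T F → R ⊆ F → IsRayDirection R F (u F)) → torsion T s R J u = 0

/-- Invariance of the scaling under all translations that preserve the tiling. -/
def IsTranslationInvariant (T : Set (Set (E d))) (s : Set (E d) → ℝ) : Prop :=
  ∀ v : E d, (fun A : Set (E d) => v +ᵥ A) '' T = T → ∀ F, IsFacet T F → s (v +ᵥ F) = s F

/-- Two tiles are adjacent if they share a facet. -/
def Adjacent (T : Set (Set (E d))) (A B : Set (E d)) : Prop :=
  A ∈ T ∧ B ∈ T ∧ A ≠ B ∧ IsFacet T (A ∩ B)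

/-- `n` is the unit normal to the common facet of `A` and `B`, directed from `A` to `B`. -/
def IsUnitNormal (A B : Set (E d)) (n : E d) : Prop :=
  ‖n‖ = 1 ∧ n ∈ (vectorSpan ℝ (A ∩ B))ᗮ ∧ ∀ a ∈ A, ∀ b ∈ B, ⟪n, a⟫_ℝ ≤ ⟪n, b⟫_ℝ

/-- `L`, a subset of the extended space `E d × ℝ`, is a lift of the tile `A` with normal
`(v, -1)`: it projects onto `A` and is orthogonal to `(v, -1)`. -/
def IsLift (A : Set (E d)) (L : Set (E d × ℝ)) (v : E d) : Prop :=
  Prod.fst '' L = A ∧ ∀ p ∈ L, ∀ q ∈ L, ⟪v, p.1 - q.1⟫_ℝ + (-1) * (p.2 - q.2) = 0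

/-- `GenFace T s P₀ A L v`: there is a chain of tiles from `P₀` to `A` for which the successive
lifting gives the lift `L` of `A`, with normal `(v, -1)`. The tile `P₀` is lifted to itself with
normal `(0, -1)`; a tile `B` adjacent to `A` is lifted up to the lift `L` of `A` (the two lifts
meet in a lift of `A ∩ B`), and the normal increases by `s (A ∩ B) • n`. -/
inductive GenFace (T : Set (Set (E d))) (s : Set (E d) → ℝ) (P₀ : Set (E d)) :
    Set (E d) → Set (E d × ℝ) → E d → Prop
  | base : GenFace T s P₀ P₀ (P₀ ×ˢ {0}) 0
  | step {A B : Set (E d)} {L L' : Set (E d × ℝ)} {v n : E d} :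
      GenFace T s P₀ A L v → Adjacent T A B → IsUnitNormal A B n →
      IsLift B L' (v + s (A ∩ B) • n) → Prod.fst '' (L ∩ L') = A ∩ B →
      GenFace T s P₀ B L' (v + s (A ∩ B) • n)

/-- The generatrix: the union of all lifted tiles. -/
def generatrix (T : Set (Set (E d))) (s : Set (E d) → ℝ) (P₀ : Set (E d)) : Set (E d × ℝ) :=
  {p | ∃ A L v, GenFace T s P₀ A L v ∧ p ∈ L}

/-- `c` is a centre of symmetry of `A`. -/
def IsCenter (A : Set (E d)) (c : E d) : Prop := ∀ x ∈ A, c + (c - x) ∈ A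

/-- The quadratic form `½ xᵀ Q x`. -/
def quadForm (Q : Matrix (Fin d) (Fin d) ℝ) (x : E d) : ℝ :=
  1 / 2 * ⟪x, Matrix.toEuclideanLin Q x⟫_ℝ

end ParTiling

end

open ParTiling

/-!
A canonical scaling prescribes, across each facet, the jump of an affine function, and the condition
at the ridges says that the jumps around a ridge cancel. Since two points can be joined, and a loop
of two paths can be filled in, while avoiding the faces of codimension at least three, local
consistency integrates to a global potential: an affine function on each tile, with the prescribed
jumps. Its pieces are the lifts of the tiles.

Translating the potential by a lattice vector changes it by a single affine function, so the
gradients depend additively on the lattice vector, and comparing the constant terms of the sum of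
two lattice vectors in both orders shows that the resulting linear map is symmetric. With `Q` its
matrix, the piece over the tile `v + P₀` is the tangent of the paraboloid at `v + c`, that is,
`x ↦ Q(x - c) - Q(x - c - v)`. Because the jumps are positive, `P₀` is cut out by the inequalities
saying that no other piece lies above its own, so it is the Dirichlet–Voronoi cell of `c` for `Q`;
its boundedness makes `Q` positive definite, and the symmetry of the lattice makes `c` its centre.
-/

noncomputable section

namespace ParTiling

/-! ### Convex sets and their faces -/

section NormedSpace

variable {V : Type*} [NormedAddCommGroup V] [NormedSpace ℝ V]

lemma eq_of_isExposed_of_inter_interior_nonempty {A F : Set V} (h : IsExposed ℝ A F)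
    (hi : (F ∩ interior A).Nonempty) : F = A := by
  obtain ⟨x, hxF, hxA⟩ := hi
  obtain ⟨l, rfl⟩ := h ⟨x, hxF⟩
  have hmax : IsLocalMax l x := by
    filter_upwards [isOpen_interior.mem_nhds hxA] with y hy using hxF.2 y (interior_subset hy)
  have hl : l = 0 := by simpa using hmax.fderiv_eq_zero
  ext y
  simp [hl]

lemma eq_of_isExposed_inter_of_mem_interior {A B : Set V} (hA : IsExposed ℝ A (A ∩ B))
    (hB : IsExposed ℝ B (A ∩ B)) {x : V} (hxA : x ∈ A) (hxB : x ∈ interior B) : A = B := by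
  have hBA : A ∩ B = B :=
    eq_of_isExposed_of_inter_interior_nonempty hB ⟨x, ⟨hxA, interior_subset hxB⟩, hxB⟩
  have hAB : A ∩ B = A := eq_of_isExposed_of_inter_interior_nonempty hA
    ⟨x, ⟨hxA, interior_subset hxB⟩, interior_mono (Set.inter_eq_right.1 hBA) hxB⟩
  rw [← hAB, hBA]

lemma eventually_add_smul_mem_of_mem_intrinsicInterior {F : Set V} {w h : V}
    (hw : w ∈ intrinsicInterior ℝ F) (hh : h ∈ vectorSpan ℝ F) :
    ∀ᶠ t : ℝ in nhds 0, w + t • h ∈ F := by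
  obtain ⟨w, hw, rfl⟩ := hw
  have hmem (t : ℝ) : t • h +ᵥ (w : V) ∈ affineSpan ℝ F :=
    AffineSubspace.vadd_mem_of_mem_direction
      (direction_affineSpan ℝ F ▸ Submodule.smul_mem _ t hh) w.2
  let φ : ℝ → affineSpan ℝ F := fun t => ⟨t • h +ᵥ (w : V), hmem t⟩
  have hφ : Continuous φ := Continuous.subtype_mk (by simp only [vadd_eq_add]; fun_prop) _
  have hφ₀ : φ 0 = w := Subtype.ext (by simp [φ])
  filter_upwards [hφ.continuousAt.preimage_mem_nhds (hφ₀.symm ▸ isOpen_interior.mem_nhds hw)]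
    with t ht
  rw [add_comm]
  exact interior_subset (s := Subtype.val ⁻¹' F) ht

lemma exists_mem_openSegment_of_mem_intrinsicInterior {F : Set V} {w y : V}
    (hw : w ∈ intrinsicInterior ℝ F) (hy : y ∈ F) : ∃ z ∈ F, w ∈ openSegment ℝ y z := by
  have hdir : w - y ∈ vectorSpan ℝ F := vsub_mem_vectorSpan ℝ (intrinsicInterior_subset hw) hy
  obtain ⟨t, hwt, ht⟩ := (((eventually_add_smul_mem_of_mem_intrinsicInterior hw hdir).filter_mono
    nhdsWithin_le_nhds).and (self_mem_nhdsWithin (s := Set.Ioi 0))).exists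
  replace ht : 0 < t := ht
  refine ⟨_, hwt, t / (1 + t), 1 / (1 + t), by positivity, by positivity, by field_simp; ring, ?_⟩
  match_scalars <;> field_simp
  ring

end NormedSpace

section InnerProductSpace

variable {V : Type*} [NormedAddCommGroup V] [InnerProductSpace ℝ V] {A F : Set V} {n : V}

lemma inner_lt_of_mem_interior {x : V} {β : ℝ} (hn : n ≠ 0) (h : ∀ y ∈ A, ⟪n, y⟫_ℝ ≤ β)
    (hx : x ∈ interior A) : ⟪n, x⟫_ℝ < β := by
  have hnear : ∀ᶠ t : ℝ in nhds 0, x + t • n ∈ A :=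
    (Continuous.tendsto' (by fun_prop) 0 x (by simp)).eventually (mem_interior_iff_mem_nhds.1 hx)
  obtain ⟨t, hxt, ht⟩ := ((hnear.filter_mono nhdsWithin_le_nhds).and
    (self_mem_nhdsWithin (s := Set.Ioi 0))).exists
  have hle := h _ hxt
  rw [inner_add_right, inner_smul_right] at hle
  linarith [mul_pos ht (real_inner_self_pos.2 hn)]

lemma mem_vectorSpan_orthogonal_iff :
    n ∈ (vectorSpan ℝ F)ᗮ ↔ ∀ x ∈ F, ∀ y ∈ F, ⟪n, x⟫_ℝ = ⟪n, y⟫_ℝ := by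
  have hle : n ∈ (vectorSpan ℝ F)ᗮ ↔ vectorSpan ℝ F ≤ (ℝ ∙ n)ᗮ := by
    rw [← Submodule.span_singleton_le_iff_mem, ← Submodule.isOrtho_iff_le, Submodule.isOrtho_comm,
      Submodule.isOrtho_iff_le]
  rw [hle]
  simp only [vectorSpan_def, Submodule.span_le, Set.vsub_subset_iff, SetLike.mem_coe,
    Submodule.mem_orthogonal_singleton_iff_inner_right, vsub_eq_sub, inner_sub_right, sub_eq_zero]

/-- The face of `A` on which the linear functional `⟪n, ·⟫` is maximal. -/
def maxFace (n : V) (A : Set V) : Set V := {x ∈ A | ∀ y ∈ A, ⟪n, y⟫_ℝ ≤ ⟪n, x⟫_ℝ}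

lemma isExposed_maxFace (n : V) (A : Set V) : IsExposed ℝ A (maxFace n A) :=
  ContinuousLinearMap.toExposed.isExposed (l := innerSL ℝ n)

lemma maxFace_subset (n : V) (A : Set V) : maxFace n A ⊆ A := Set.sep_subset _ _

lemma mem_vectorSpan_maxFace_orthogonal (n : V) (A : Set V) :
    n ∈ (vectorSpan ℝ (maxFace n A))ᗮ :=
  mem_vectorSpan_orthogonal_iff.2 fun _ hx _ hy => le_antisymm (hy.2 _ hx.1) (hx.2 _ hy.1)

lemma exists_unit_eq_maxFace [CompleteSpace V] (h : IsExposed ℝ A F) (hne : F.Nonempty)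
    (hFA : F ≠ A) : ∃ n : V, ‖n‖ = 1 ∧ F = maxFace n A := by
  obtain ⟨l, hl⟩ := h hne
  obtain ⟨m, rfl⟩ := (InnerProductSpace.toDual ℝ V).surjective l
  simp only [InnerProductSpace.toDual_apply_apply] at hl
  have hm : m ≠ 0 := by
    rintro rfl
    exact hFA (by simp [hl])
  refine ⟨‖m‖⁻¹ • m, norm_smul_inv_norm hm, ?_⟩
  have hpos : 0 < ‖m‖⁻¹ := inv_pos.2 (norm_pos_iff.2 hm)
  simp only [hl, maxFace, real_inner_smul_left, mul_le_mul_iff_right₀ hpos]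

end InnerProductSpace

section Dim

variable {d : ℕ} {A F G : Set (E d)} {m n : E d}

lemma dim_mono (h : F ⊆ G) : dim F ≤ dim G := Submodule.finrank_mono (vectorSpan_mono ℝ h)

lemma dim_eq_of_interior_nonempty (hA : (interior A).Nonempty) : dim A = d := by
  have hspan : affineSpan ℝ A = ⊤ :=
    top_le_iff.1 (isOpen_interior.affineSpan_eq_top hA ▸ affineSpan_mono ℝ interior_subset)
  rw [dim, ← direction_affineSpan, hspan, AffineSubspace.direction_top, finrank_top,
    finrank_euclideanSpace_fin]

lemma dim_union_le (hF : F.Nonempty) (hG : G.Nonempty) : dim (F ∪ G) ≤ dim F + dim G + 1 := by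
  obtain ⟨p, hp⟩ := hF
  obtain ⟨q, hq⟩ := hG
  rw [dim, ← direction_affineSpan, AffineSubspace.span_union,
    AffineSubspace.direction_sup (subset_affineSpan ℝ F hp) (subset_affineSpan ℝ G hq),
    direction_affineSpan, direction_affineSpan]
  refine (Submodule.finrank_add_le_finrank_add_finrank _ _).trans (add_le_add ?_ ?_)
  · exact Submodule.finrank_add_le_finrank_add_finrank _ _
  · exact (finrank_span_le_card _).trans_eq (by simp)

lemma exists_mem_forall_notMem_affineSpan {𝒮 : Set (Set (E d))} (h𝒮 : 𝒮.Countable)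
    (hdim : ∀ F ∈ 𝒮, dim F < d) {O : Set (E d)} (hO : IsOpen O) (hne : O.Nonempty) :
    ∃ y ∈ O, ∀ F ∈ 𝒮, y ∉ affineSpan ℝ F := by
  by_contra! hcover
  have hnull : MeasureTheory.volume (⋃ F ∈ 𝒮, (affineSpan ℝ F : Set (E d))) = 0 := by
    refine (MeasureTheory.measure_biUnion_null_iff h𝒮).2 fun F hF =>
      MeasureTheory.Measure.addHaar_affineSubspace _ _ fun htop => (hdim F hF).ne ?_
    rw [dim, ← direction_affineSpan, htop, AffineSubspace.direction_top, finrank_top,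
      finrank_euclideanSpace_fin]
  refine (hO.measure_pos MeasureTheory.volume hne).ne'
    (MeasureTheory.measure_mono_null (fun y hy => ?_) hnull)
  obtain ⟨F, hF, hyF⟩ := hcover y hy
  exact Set.mem_biUnion hF hyF

lemma dim_add_finrank_orthogonal (F : Set (E d)) :
    dim F + Module.finrank ℝ (vectorSpan ℝ F)ᗮ = d := by
  rw [dim, Submodule.finrank_add_finrank_orthogonal, finrank_euclideanSpace_fin]

lemma dim_lt_of_mem_orthogonal (hn : n ≠ 0) (h : n ∈ (vectorSpan ℝ F)ᗮ) : dim F < d := by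
  have hpos : 0 < Module.finrank ℝ (vectorSpan ℝ F)ᗮ :=
    Module.finrank_pos_iff_exists_ne_zero.2 ⟨⟨n, h⟩, by simpa using hn⟩
  have := dim_add_finrank_orthogonal F
  omega

lemma vectorSpan_orthogonal_eq_span (hF : d ≤ dim F + 1) (hn : n ≠ 0)
    (h : n ∈ (vectorSpan ℝ F)ᗮ) : (vectorSpan ℝ F)ᗮ = ℝ ∙ n := by
  refine (Submodule.eq_of_le_of_finrank_le ((Submodule.span_singleton_le_iff_mem _ _).2 h) ?_).symm
  have := dim_add_finrank_orthogonal F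
  rw [finrank_span_singleton hn]
  omega

lemma mem_vectorSpan_of_inner_eq_zero {h : E d} (hF : d ≤ dim F + 1) (hn : n ≠ 0)
    (hnF : n ∈ (vectorSpan ℝ F)ᗮ) (hh : ⟪n, h⟫_ℝ = 0) : h ∈ vectorSpan ℝ F := by
  rw [← Submodule.orthogonal_orthogonal (vectorSpan ℝ F), vectorSpan_orthogonal_eq_span hF hn hnF]
  exact Submodule.mem_orthogonal_singleton_iff_inner_right.2 hh

lemma eq_or_eq_neg_of_mem_orthogonal (hF : d ≤ dim F + 1) (hm : ‖m‖ = 1) (hn : ‖n‖ = 1)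
    (hmF : m ∈ (vectorSpan ℝ F)ᗮ) (hnF : n ∈ (vectorSpan ℝ F)ᗮ) : m = n ∨ m = -n := by
  rw [vectorSpan_orthogonal_eq_span hF (ne_zero_of_norm_ne_zero (hn ▸ one_ne_zero)) hnF,
    Submodule.mem_span_singleton] at hmF
  obtain ⟨k, rfl⟩ := hmF
  rw [norm_smul, hn, mul_one, Real.norm_eq_abs] at hm
  rcases eq_or_eq_neg_of_abs_eq hm with rfl | rfl <;> simp

/-- Near a relatively interior point `w` of a facet `F` of `A`, the set `A` fills its side of
`F`. -/
lemma exists_add_smul_sub_mem_of_inner_lt (hA : Convex ℝ A) (hFA : F ⊆ A) {w a b : E d}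
    (hF : d ≤ dim F + 1) (hn : n ≠ 0) (hnF : n ∈ (vectorSpan ℝ F)ᗮ)
    (hw : w ∈ intrinsicInterior ℝ F) (ha : a ∈ A) (haw : ⟪n, a⟫_ℝ < ⟪n, w⟫_ℝ)
    (hbw : ⟪n, b⟫_ℝ < ⟪n, w⟫_ℝ) : ∃ ε ∈ Set.Ioo (0 : ℝ) 1, w + ε • (b - w) ∈ A := by
  set τ := (⟪n, w⟫_ℝ - ⟪n, b⟫_ℝ) / (⟪n, w⟫_ℝ - ⟪n, a⟫_ℝ) with hτ
  have hpos : 0 < ⟪n, w⟫_ℝ - ⟪n, a⟫_ℝ := sub_pos.2 haw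
  have hτ0 : 0 < τ := div_pos (sub_pos.2 hbw) hpos
  have hpar : (b - w) - τ • (a - w) ∈ vectorSpan ℝ F := by
    refine mem_vectorSpan_of_inner_eq_zero hF hn hnF ?_
    rw [inner_sub_right, inner_smul_right, inner_sub_right, inner_sub_right, hτ]
    field_simp
    ring
  obtain ⟨t, hwt, ht0, ht1⟩ := (((eventually_add_smul_mem_of_mem_intrinsicInterior hw
    hpar).filter_mono nhdsWithin_le_nhds).and (Ioo_mem_nhdsGT one_pos)).exists
  have hpos' : 0 < 1 + t * τ := by positivity
  refine ⟨t / (1 + t * τ), ⟨by positivity, (div_lt_one hpos').2 (by nlinarith)⟩, ?_⟩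
  convert hA (hFA hwt) ha (a := 1 / (1 + t * τ)) (b := t * τ / (1 + t * τ)) (by positivity)
    (by positivity) (by field_simp) using 1
  match_scalars <;> field_simp <;> ring

end Dim

/-! ### Normal tilings -/

section NormalTiling

variable {d : ℕ}

/-- A locally finite face-to-face tiling of space by closed convex sets with interior points. Tiles
may be unbounded, and need not be translates of each other. -/
structure IsNormalTiling (T : Set (Set (E d))) : Prop where
  isClosed : ∀ ⦃A⦄, A ∈ T → IsClosed A
  convex : ∀ ⦃A⦄, A ∈ T → Convex ℝ A
  interior_nonempty : ∀ ⦃A⦄, A ∈ T → (interior A).Nonempty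
  sUnion_eq : ⋃₀ T = Set.univ
  isExposed_inter : ∀ ⦃A⦄, A ∈ T → ∀ ⦃B⦄, B ∈ T → IsExposed ℝ A (A ∩ B)
  locallyFinite : LocallyFinite fun A : T => (A : Set (E d))

/-- The intersection of all tiles containing `x`: the smallest face of the tiling at `x`. -/
def minFace (T : Set (Set (E d))) (x : E d) : Set (E d) := ⋂₀ {A ∈ T | x ∈ A}

/-- The points of the tiling that lie on no face of codimension greater than `k`. -/
def codimLE (T : Set (Set (E d))) (k : ℕ) : Set (E d) := {x | d ≤ dim (minFace T x) + k}

variable {T : Set (Set (E d))} {A B : Set (E d)} {x : E d}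

lemma mem_minFace (T : Set (Set (E d))) (x : E d) : x ∈ minFace T x := fun _ hA => hA.2

lemma minFace_subset (hA : A ∈ T) (hx : x ∈ A) : minFace T x ⊆ A :=
  Set.sInter_subset_of_mem ⟨hA, hx⟩

namespace IsNormalTiling

lemma eq_of_mem_interior (hT : IsNormalTiling T) (hA : A ∈ T) (hB : B ∈ T)
    (hxA : x ∈ A) (hxB : x ∈ interior B) : A = B :=
  eq_of_isExposed_inter_of_mem_interior (hT.isExposed_inter hA hB)
    (Set.inter_comm B A ▸ hT.isExposed_inter hB hA) hxA hxB

lemma inter_ne_left (hT : IsNormalTiling T) (hA : A ∈ T) (hB : B ∈ T) (hAB : A ≠ B) :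
    A ∩ B ≠ A := by
  intro h
  obtain ⟨x, hx⟩ := hT.interior_nonempty hA
  exact hAB (hT.eq_of_mem_interior hB hA (Set.inter_eq_left.1 h (interior_subset hx)) hx).symm

lemma exists_mem (hT : IsNormalTiling T) (x : E d) : ∃ A ∈ T, x ∈ A :=
  Set.mem_sUnion.1 (hT.sUnion_eq ▸ Set.mem_univ x)

lemma nonempty (hT : IsNormalTiling T) (hA : A ∈ T) : A.Nonempty :=
  (hT.interior_nonempty hA).mono interior_subset

lemma interior_inter_nonempty (hT : IsNormalTiling T) (hA : A ∈ T) {O : Set (E d)}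
    (hO : IsOpen O) (h : (A ∩ O).Nonempty) : (interior A ∩ O).Nonempty := by
  rw [Set.inter_comm] at h ⊢
  refine (closure_inter_open_nonempty_iff hO).1 ?_ |>.mono fun y hy => ⟨hy.2, hy.1⟩
  rw [(hT.convex hA).closure_interior_eq_closure_of_nonempty_interior (hT.interior_nonempty hA)]
  exact h.mono fun y hy => ⟨subset_closure hy.2, hy.1⟩

lemma mem_of_mem_openSegment (hT : IsNormalTiling T) (hA : A ∈ T) (hB : B ∈ T) {y w : E d}
    (hx : x ∈ A) (hy : y ∈ A) (hw : w ∈ openSegment ℝ x y) (hwB : w ∈ B) : x ∈ B :=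
  ((hT.isExposed_inter hA hB).isExtreme.left_mem_of_mem_openSegment hx hy
    ⟨(hT.convex hA).openSegment_subset hx hy hw, hwB⟩ hw).2

lemma subset_of_mem_intrinsicInterior (hT : IsNormalTiling T) (hA : A ∈ T) (hB : B ∈ T)
    {F : Set (E d)} (hFA : F ⊆ A) {w : E d} (hw : w ∈ intrinsicInterior ℝ F) (hwB : w ∈ B) :
    F ⊆ B := by
  intro y hy
  obtain ⟨z, hz, hwyz⟩ := exists_mem_openSegment_of_mem_intrinsicInterior hw hy
  exact hT.mem_of_mem_openSegment hA hB (hFA hy) (hFA hz) hwyz hwB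

lemma finite_mem (hT : IsNormalTiling T) (x : E d) : {A ∈ T | x ∈ A}.Finite := by
  convert (hT.locallyFinite.point_finite x).image Subtype.val
  ext A
  simp [and_comm]

lemma countable (hT : IsNormalTiling T) : T.Countable :=
  Set.countable_univ_iff.1 (hT.locallyFinite.countable_univ fun A => hT.nonempty A.2)

lemma isClosed_sUnion (hT : IsNormalTiling T) {S : Set (Set (E d))} (hS : S ⊆ T) :
    IsClosed (⋃₀ S) := by
  rw [Set.sUnion_eq_iUnion]
  exact (hT.locallyFinite.comp_injective (Set.inclusion_injective hS)).isClosed_iUnion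
    fun A => hT.isClosed (hS A.2)

lemma eventually_mem_of_mem (hT : IsNormalTiling T) (x : E d) :
    ∀ᶠ y in nhds x, ∀ A ∈ T, y ∈ A → x ∈ A := by
  filter_upwards [hT.locallyFinite.eventually_subset (fun A => hT.isClosed A.2) x]
    with y hy A hA hyA using @hy ⟨A, hA⟩ hyA

lemma countable_range_minFace (hT : IsNormalTiling T) : (Set.range (minFace T)).Countable := by
  refine ((Set.countable_ofPred_finite_subset hT.countable).image Set.sInter).mono ?_
  rintro _ ⟨x, rfl⟩
  exact ⟨_, ⟨hT.finite_mem x, fun A hA => hA.1⟩, rfl⟩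

lemma isExposed_minFace (hT : IsNormalTiling T) (hA : A ∈ T) (hx : x ∈ A) :
    IsExposed ℝ A (minFace T x) := by
  have hfin := (hT.finite_mem x).image (A ∩ ·)
  have hne : hfin.toFinset.Nonempty := ⟨A ∩ A, hfin.mem_toFinset.2 ⟨A, ⟨hA, hx⟩, rfl⟩⟩
  have heq : minFace T x = ⋂₀ hfin.toFinset := by
    ext y
    simp only [minFace, Set.mem_sInter, Set.Finite.coe_toFinset, Set.forall_mem_image]
    exact ⟨fun h B hB => ⟨h A ⟨hA, hx⟩, h B hB⟩, fun h B hB => (h hB).2⟩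
  rw [heq]
  refine IsExposed.sInter hne fun F hF => ?_
  obtain ⟨B, hB, rfl⟩ := hfin.mem_toFinset.1 hF
  exact hT.isExposed_inter hA hB.1

/-- The faces of codimension more than `j + 1` span with each of the sets `Q` a proper affine
subspace, and these countably many subspaces do not cover an open set. -/
lemma exists_mem_forall_segment_mem_codimLE (hT : IsNormalTiling T) {𝒬 : Set (Set (E d))}
    (h𝒬 : 𝒬.Countable) {j : ℕ} (hdim : ∀ Q ∈ 𝒬, dim Q ≤ j) {O : Set (E d)} (hO : IsOpen O)
    (hne : O.Nonempty) :
    ∃ y ∈ O, ∀ Q ∈ 𝒬, ∀ q ∈ Q, ∀ w ∈ segment ℝ q y, w ≠ q → w ∈ codimLE T (j + 1) := by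
  set 𝓕 := {F ∈ Set.range (minFace T) | F.Nonempty ∧ dim F + (j + 1) < d}
  set 𝒬' := {Q ∈ 𝒬 | Q.Nonempty}
  obtain ⟨y, hyO, hy⟩ := exists_mem_forall_notMem_affineSpan (𝒮 := Set.image2 (· ∪ ·) 𝒬' 𝓕)
    ((h𝒬.mono (Set.sep_subset _ _)).image2 (hT.countable_range_minFace.mono (Set.sep_subset _ _))
      _) (by
      rintro _ ⟨Q, ⟨hQ, hQne⟩, F, ⟨-, hFne, hF⟩, rfl⟩
      exact (dim_union_le hQne hFne).trans_lt (by have := hdim Q hQ; omega)) hO hne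
  refine ⟨y, hyO, fun Q hQ q hq w hw hwq => ?_⟩
  by_contra hlow
  have hF : minFace T w ∈ 𝓕 := ⟨⟨w, rfl⟩, ⟨w, mem_minFace T w⟩, not_le.1 hlow⟩
  refine hy _ ⟨Q, ⟨hQ, q, hq⟩, _, hF, rfl⟩ ?_
  have hqspan : q ∈ affineSpan ℝ (Q ∪ minFace T w) := subset_affineSpan ℝ _ (Or.inl hq)
  have hwspan : w ∈ affineSpan ℝ (Q ∪ minFace T w) :=
    subset_affineSpan ℝ _ (Or.inr (mem_minFace T w))
  rw [segment_eq_image_lineMap] at hw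
  obtain ⟨t, -, rfl⟩ := hw
  have ht : t ≠ 0 := by
    rintro rfl
    simp at hwq
  have hyspan := AffineMap.lineMap_mem t⁻¹ hqspan hwspan
  rwa [AffineMap.lineMap_lineMap_right, inv_mul_cancel₀ ht, AffineMap.lineMap_apply_one]
    at hyspan

lemma forall_of_isPreconnected (hT : IsNormalTiling T) {S : Set (E d)} (hS : IsPreconnected S)
    (p : Set (E d) → Prop)
    (hp : ∀ w ∈ S, ∀ A ∈ T, ∀ B ∈ T, w ∈ A → w ∈ B → p A → p B)
    (hA : A ∈ T) (hAS : (S ∩ A).Nonempty) (hpA : p A) (hB : B ∈ T) (hBS : (S ∩ B).Nonempty) :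
    p B := by
  by_contra hpB
  have hcover : S ⊆ ⋃₀ {A ∈ T | p A} ∪ ⋃₀ {A ∈ T | ¬ p A} := fun w _ => by
    obtain ⟨C, hC, hwC⟩ := hT.exists_mem w
    by_cases hpC : p C
    exacts [Or.inl ⟨C, ⟨hC, hpC⟩, hwC⟩, Or.inr ⟨C, ⟨hC, hpC⟩, hwC⟩]
  obtain ⟨w, hwS, ⟨C, hC, hwC⟩, D, hD, hwD⟩ := isPreconnected_closed_iff.1 hS
    (⋃₀ {A ∈ T | p A}) (⋃₀ {A ∈ T | ¬ p A}) (hT.isClosed_sUnion fun A hA => hA.1)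
    (hT.isClosed_sUnion fun A hA => hA.1) hcover
    (hAS.mono fun w hw => ⟨hw.1, A, ⟨hA, hpA⟩, hw.2⟩)
    (hBS.mono fun w hw => ⟨hw.1, B, ⟨hB, hpB⟩, hw.2⟩)
  exact hD.2 (hp w hwS C hC.1 D hD.1 hwC hwD hC.2)

end IsNormalTiling

end NormalTiling

/-! ### Facets and unit normals -/

section Adjacency

variable {d : ℕ} {T : Set (Set (E d))} {A B C F : Set (E d)} {m n : E d}

lemma IsUnitNormal.ne_zero (h : IsUnitNormal A B n) : n ≠ 0 :=
  ne_zero_of_norm_ne_zero (h.1 ▸ one_ne_zero)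

lemma IsUnitNormal.neg (h : IsUnitNormal A B n) : IsUnitNormal B A (-n) := by
  refine ⟨by rw [norm_neg, h.1], Set.inter_comm A B ▸ neg_mem h.2.1, fun b hb a ha => ?_⟩
  simpa only [inner_neg_left, neg_le_neg_iff] using h.2.2 a ha b hb

lemma IsUnitNormal.eq_of_forall_inner_le (hm : IsUnitNormal A B m) (hA : (interior A).Nonempty)
    (hFne : F.Nonempty) (hFAB : F ⊆ A ∩ B) (hF : d ≤ dim F + 1) (hn : ‖n‖ = 1)
    (hnF : n ∈ (vectorSpan ℝ F)ᗮ) (hle : ∀ x ∈ A, ∀ w ∈ F, ⟪n, x⟫_ℝ ≤ ⟪n, w⟫_ℝ) : m = n := by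
  have hmF : m ∈ (vectorSpan ℝ F)ᗮ := Submodule.orthogonal_le (vectorSpan_mono ℝ hFAB) hm.2.1
  rcases eq_or_eq_neg_of_mem_orthogonal hF hm.1 hn hmF hnF with h | rfl
  · exact h
  · obtain ⟨w, hw⟩ := hFne
    obtain ⟨a, ha⟩ := hA
    have hlt : ⟪n, a⟫_ℝ < ⟪n, w⟫_ℝ := inner_lt_of_mem_interior
      (ne_zero_of_norm_ne_zero (hn ▸ one_ne_zero)) (fun x hx => hle x hx w hw) ha
    have hge := hm.2.2 a (interior_subset ha) w (hFAB hw).2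
    rw [inner_neg_left, inner_neg_left, neg_le_neg_iff] at hge
    exact absurd hge hlt.not_ge

lemma Adjacent.symm (h : Adjacent T A B) : Adjacent T B A :=
  ⟨h.2.1, h.1, h.2.2.1.symm, Set.inter_comm A B ▸ h.2.2.2⟩

lemma Adjacent.nonempty (h : Adjacent T A B) : (A ∩ B).Nonempty := h.2.2.2.1.1

lemma Adjacent.dim_eq (h : Adjacent T A B) : dim (A ∩ B) + 1 = d := h.2.2.2.2

namespace IsNormalTiling

lemma exists_unit_inter_eq_maxFace (hT : IsNormalTiling T) (hA : A ∈ T) (hB : B ∈ T)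
    (hAB : A ≠ B) (hne : (A ∩ B).Nonempty) : ∃ n, ‖n‖ = 1 ∧ A ∩ B = maxFace n A :=
  exists_unit_eq_maxFace (hT.isExposed_inter hA hB) hne (hT.inter_ne_left hA hB hAB)

lemma adjacent_of_le_dim (hT : IsNormalTiling T) (hA : A ∈ T) (hB : B ∈ T)
    (hAB : A ≠ B) (hne : (A ∩ B).Nonempty) (h : d ≤ dim (A ∩ B) + 1) : Adjacent T A B := by
  obtain ⟨n, hn, hF⟩ := hT.exists_unit_inter_eq_maxFace hA hB hAB hne
  have hlt : dim (A ∩ B) < d := dim_lt_of_mem_orthogonal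
    (ne_zero_of_norm_ne_zero (hn ▸ one_ne_zero)) (hF ▸ mem_vectorSpan_maxFace_orthogonal n A)
  exact ⟨hA, hB, hAB, ⟨hne, A, hA, hT.isExposed_inter hA hB⟩, le_antisymm hlt h⟩

lemma eq_of_forall_inner_le (hT : IsNormalTiling T) (hA : A ∈ T) (hB : B ∈ T)
    (hFc : Convex ℝ F) (hFne : F.Nonempty) (hFA : F ⊆ A) (hFB : F ⊆ B) (hF : d ≤ dim F + 1)
    (hn : n ≠ 0) (hnF : n ∈ (vectorSpan ℝ F)ᗮ)
    (hle : ∀ x ∈ A ∪ B, ∀ w ∈ F, ⟪n, x⟫_ℝ ≤ ⟪n, w⟫_ℝ) : A = B := by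
  obtain ⟨w, hw⟩ := hFne.intrinsicInterior hFc
  have hwF := intrinsicInterior_subset hw
  obtain ⟨a, ha⟩ := hT.interior_nonempty hA
  obtain ⟨b, hb⟩ := hT.interior_nonempty hB
  have ha' : ⟪n, a⟫_ℝ < ⟪n, w⟫_ℝ :=
    inner_lt_of_mem_interior hn (fun y hy => hle y (Or.inl hy) w hwF) ha
  have hb' : ⟪n, b⟫_ℝ < ⟪n, w⟫_ℝ :=
    inner_lt_of_mem_interior hn (fun y hy => hle y (Or.inr hy) w hwF) hb
  obtain ⟨ε, ⟨hε0, hε1⟩, hmem⟩ := exists_add_smul_sub_mem_of_inner_lt (hT.convex hA) hFA hF hn hnF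
    hw (interior_subset ha) ha' hb'
  refine hT.eq_of_mem_interior hA hB hmem ?_
  convert (hT.convex hB).combo_interior_self_mem_interior hb (hFB hwF) hε0
    (sub_nonneg.2 hε1.le) (by ring) using 1
  module

lemma isUnitNormal_of_inter_eq_maxFace (hT : IsNormalTiling T) (h : Adjacent T A B)
    (hn : ‖n‖ = 1) (hF : A ∩ B = maxFace n A) : IsUnitNormal A B n := by
  obtain ⟨m, hm, hF'⟩ :=
    hT.exists_unit_inter_eq_maxFace h.2.1 h.1 h.2.2.1.symm h.symm.nonempty
  rw [Set.inter_comm] at hF'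
  have hnF : n ∈ (vectorSpan ℝ (A ∩ B))ᗮ := hF ▸ mem_vectorSpan_maxFace_orthogonal n A
  have hleA : ∀ x ∈ A, ∀ w ∈ A ∩ B, ⟪n, x⟫_ℝ ≤ ⟪n, w⟫_ℝ := fun x hx w hw => (hF ▸ hw).2 x hx
  have hleB : ∀ x ∈ B, ∀ w ∈ A ∩ B, ⟪m, x⟫_ℝ ≤ ⟪m, w⟫_ℝ := fun x hx w hw => (hF' ▸ hw).2 x hx
  have hmn : m = -n := by
    refine (eq_or_eq_neg_of_mem_orthogonal h.dim_eq.ge hm hn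
      (hF' ▸ mem_vectorSpan_maxFace_orthogonal m B) hnF).resolve_left ?_
    rintro rfl
    exact h.2.2.1 (hT.eq_of_forall_inner_le h.1 h.2.1 ((hT.convex h.1).inter (hT.convex h.2.1))
      h.nonempty Set.inter_subset_left Set.inter_subset_right h.dim_eq.ge
      (ne_zero_of_norm_ne_zero (hn ▸ one_ne_zero)) hnF
      fun x hx w hw => hx.elim (hleA x · w hw) (hleB x · w hw))
  refine ⟨hn, hnF, fun a ha b hb => ?_⟩
  obtain ⟨w, hw⟩ := h.nonempty
  have hwb := hleB b hb w hw
  rw [hmn, inner_neg_left, inner_neg_left, neg_le_neg_iff] at hwb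
  exact (hleA a ha w hw).trans hwb

lemma exists_isUnitNormal (hT : IsNormalTiling T) (h : Adjacent T A B) :
    ∃ n, IsUnitNormal A B n := by
  obtain ⟨n, hn, hF⟩ := hT.exists_unit_inter_eq_maxFace h.1 h.2.1 h.2.2.1 h.nonempty
  exact ⟨n, hT.isUnitNormal_of_inter_eq_maxFace h hn hF⟩

lemma isUnitNormal_unique (hT : IsNormalTiling T) (h : Adjacent T A B)
    (hm : IsUnitNormal A B m) (hn : IsUnitNormal A B n) : m = n :=
  hm.eq_of_forall_inner_le (hT.interior_nonempty h.1) h.nonempty subset_rfl h.dim_eq.ge hn.1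
    hn.2.1 fun x hx w hw => hn.2.2 x hx w hw.2

lemma inter_eq_maxFace (hT : IsNormalTiling T) (h : Adjacent T A B) (hn : IsUnitNormal A B n) :
    A ∩ B = maxFace n A := by
  obtain ⟨m, hm, hF⟩ := hT.exists_unit_inter_eq_maxFace h.1 h.2.1 h.2.2.1 h.nonempty
  rwa [hT.isUnitNormal_unique h hn (hT.isUnitNormal_of_inter_eq_maxFace h hm hF)]

lemma mem_of_inner_eq (hT : IsNormalTiling T) (h : Adjacent T A B) {w x : E d}
    (hn : IsUnitNormal A B n) (hw : w ∈ A ∩ B) (hx : x ∈ A) (hxw : ⟪n, x⟫_ℝ = ⟪n, w⟫_ℝ) :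
    x ∈ B := by
  have hxF : x ∈ maxFace n A := ⟨hx, fun y hy => hxw ▸ hn.2.2 y hy w hw.2⟩
  exact ((hT.inter_eq_maxFace h hn).symm ▸ hxF).2

lemma eq_or_eq_of_subset (hT : IsNormalTiling T) (h : Adjacent T A B) (hC : C ∈ T)
    (hne : F.Nonempty) (hF : d ≤ dim F + 1) (hFAB : F ⊆ A ∩ B) (hFC : F ⊆ C) :
    C = A ∨ C = B := by
  refine or_iff_not_imp_left.2 fun hCA => ?_
  have hGAC : A ∩ B ∩ C ⊆ A ∩ C := Set.inter_subset_inter_left C Set.inter_subset_left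
  have hGne : (A ∩ B ∩ C).Nonempty := hne.mono (Set.subset_inter hFAB hFC)
  have hGd : d ≤ dim (A ∩ B ∩ C) + 1 :=
    hF.trans (Nat.add_le_add_right (dim_mono (Set.subset_inter hFAB hFC)) 1)
  have hAC := hT.adjacent_of_le_dim h.1 hC (Ne.symm hCA) (hGne.mono hGAC)
    (hGd.trans (Nat.add_le_add_right (dim_mono hGAC) 1))
  obtain ⟨n, hn⟩ := hT.exists_isUnitNormal h
  obtain ⟨m, hm⟩ := hT.exists_isUnitNormal hAC
  have hnG : n ∈ (vectorSpan ℝ (A ∩ B ∩ C))ᗮ :=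
    Submodule.orthogonal_le (vectorSpan_mono ℝ Set.inter_subset_left) hn.2.1
  obtain rfl : m = n := hm.eq_of_forall_inner_le (hT.interior_nonempty h.1) hGne hGAC hGd hn.1 hnG
    fun x hx w hw => hn.2.2 x hx w hw.1.2
  refine hT.eq_of_forall_inner_le hC h.2.1 (((hT.convex h.1).inter (hT.convex h.2.1)).inter
    (hT.convex hC)) hGne Set.inter_subset_right (fun w hw => hw.1.2) hGd hn.neg.ne_zero
    (neg_mem hnG) ?_
  rintro x (hx | hx) w hw
  exacts [hm.neg.2.2 x hx w hw.1.1, hn.neg.2.2 x hx w hw.1.1]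

lemma exists_union_mem_nhds (hT : IsNormalTiling T) (h : Adjacent T A B) :
    ∃ w ∈ A ∩ B, A ∪ B ∈ nhds w := by
  obtain ⟨w, hw⟩ := h.nonempty.intrinsicInterior ((hT.convex h.1).inter (hT.convex h.2.1))
  refine ⟨w, intrinsicInterior_subset hw, ?_⟩
  filter_upwards [hT.eventually_mem_of_mem w] with y hy
  obtain ⟨C, hC, hyC⟩ := hT.exists_mem y
  have hFC := hT.subset_of_mem_intrinsicInterior h.1 hC Set.inter_subset_left hw (hy C hC hyC)
  rcases hT.eq_or_eq_of_subset h hC h.nonempty h.dim_eq.ge subset_rfl hFC with rfl | rfl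
  exacts [Or.inl hyC, Or.inr hyC]

lemma exists_adjacent_inter_eq (hT : IsNormalTiling T) (hA : A ∈ T) (hF : IsExposed ℝ A F)
    (hne : F.Nonempty) (hd : dim F + 1 = d) : ∃ B, Adjacent T A B ∧ A ∩ B = F := by
  have hFA : F ≠ A := by
    rintro rfl
    rw [dim_eq_of_interior_nonempty (hT.interior_nonempty hA)] at hd
    omega
  obtain ⟨n, hn, rfl⟩ := exists_unit_eq_maxFace hF hne hFA
  have hn0 : n ≠ 0 := ne_zero_of_norm_ne_zero (hn ▸ one_ne_zero)
  obtain ⟨w, hw⟩ := hne.intrinsicInterior (hF.convex (hT.convex hA))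
  have hwF := intrinsicInterior_subset hw
  have hnear : ∀ᶠ t : ℝ in nhds 0, ∀ B ∈ T, w + t • n ∈ B → w ∈ B :=
    (Continuous.tendsto' (by fun_prop) 0 w (by simp)).eventually (hT.eventually_mem_of_mem w)
  obtain ⟨t, hwt, ht⟩ := ((hnear.filter_mono nhdsWithin_le_nhds).and
    (self_mem_nhdsWithin (s := Set.Ioi 0))).exists
  obtain ⟨B, hB, hyB⟩ := hT.exists_mem (w + t • n)
  have hFAB : maxFace n A ⊆ A ∩ B := Set.subset_inter hF.subset
    (hT.subset_of_mem_intrinsicInterior hA hB hF.subset hw (hwt B hB hyB))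
  have hAB : A ≠ B := by
    rintro rfl
    have hle := hwF.2 _ hyB
    rw [inner_add_right, inner_smul_right] at hle
    linarith [mul_pos ht (real_inner_self_pos.2 hn0)]
  have hadj := hT.adjacent_of_le_dim hA hB hAB (hne.mono hFAB)
    (hd.ge.trans (Nat.add_le_add_right (dim_mono hFAB) 1))
  obtain ⟨m, hm⟩ := hT.exists_isUnitNormal hadj
  obtain rfl : m = n := hm.eq_of_forall_inner_le (hT.interior_nonempty hA) hne hFAB hd.ge hn
    (mem_vectorSpan_maxFace_orthogonal n A) fun x hx w hw => hw.2 x hx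
  exact ⟨B, hadj, hT.inter_eq_maxFace hadj hm⟩

lemma eq_or_adjacent_of_mem_codimLE (hT : IsNormalTiling T) (hA : A ∈ T) (hB : B ∈ T) {w : E d}
    (hw : w ∈ codimLE T 1) (hwA : w ∈ A) (hwB : w ∈ B) : A = B ∨ Adjacent T A B := by
  refine or_iff_not_imp_left.2 fun hAB => hT.adjacent_of_le_dim hA hB hAB ⟨w, hwA, hwB⟩ ?_
  exact hw.trans (Nat.add_le_add_right
    (dim_mono (Set.subset_inter (minFace_subset hA hwA) (minFace_subset hB hwB))) 1)

/-- Near `x`, a generic segment from the interior of `A` to the interior of `B` crosses only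
facets. -/
lemma forall_mem_of_adjacent (hT : IsNormalTiling T) {x : E d} (p : Set (E d) → Prop)
    (hp : ∀ A B, Adjacent T A B → x ∈ A ∩ B → p A → p B)
    (hA : A ∈ T) (hxA : x ∈ A) (hpA : p A) (hB : B ∈ T) (hxB : x ∈ B) : p B := by
  obtain ⟨ε, hε, hball⟩ := Metric.eventually_nhds_iff_ball.1 (hT.eventually_mem_of_mem x)
  have hx : x ∈ Metric.ball x ε := Metric.mem_ball_self hε
  obtain ⟨a, haA, ha⟩ := hT.interior_inter_nonempty hA Metric.isOpen_ball ⟨x, hxA, hx⟩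
  obtain ⟨b, ⟨hbB, hb⟩, hgen⟩ := hT.exists_mem_forall_segment_mem_codimLE (𝒬 := {{a}})
    (Set.countable_singleton _) (j := 0) (by simp [dim]) (isOpen_interior.inter Metric.isOpen_ball)
    (hT.interior_inter_nonempty hB Metric.isOpen_ball ⟨x, hxB, hx⟩)
  refine hT.forall_of_isPreconnected (convex_segment a b).isPreconnected p ?_ hA
    ⟨a, left_mem_segment ℝ a b, interior_subset haA⟩ hpA hB
    ⟨b, right_mem_segment ℝ a b, interior_subset hbB⟩
  intro w hw C hC D hD hwC hwD hpC
  have hxw := hball w ((convex_ball x ε).segment_subset ha hb hw)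
  have hCD : C = D ∨ Adjacent T C D := by
    by_cases hwa : w = a
    · subst hwa
      exact Or.inl ((hT.eq_of_mem_interior hC hA hwC haA).trans
        (hT.eq_of_mem_interior hD hA hwD haA).symm)
    · exact hT.eq_or_adjacent_of_mem_codimLE hC hD (hgen _ rfl a rfl w hw hwa) hwC hwD
  rcases hCD with rfl | hCD
  exacts [hpC, hp C D hCD ⟨hxw C hC hwC, hxw D hD hwD⟩ hpC]

lemma forall_of_adjacent (hT : IsNormalTiling T) {S : Set (E d)} (hS : IsPreconnected S)
    (p : Set (E d) → Prop) (hp : ∀ A B, Adjacent T A B → (A ∩ B ∩ S).Nonempty → p A → p B)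
    (hA : A ∈ T) (hAS : (S ∩ A).Nonempty) (hpA : p A) (hB : B ∈ T) (hBS : (S ∩ B).Nonempty) :
    p B :=
  hT.forall_of_isPreconnected hS p (fun w hwS _ hC _ hD hwC hwD hpC =>
    hT.forall_mem_of_adjacent p (fun C D hCD hw => hp C D hCD ⟨w, hw, hwS⟩) hC hwC hpC hD hwD)
    hA hAS hpA hB hBS

lemma forall_of_adjacent_univ (hT : IsNormalTiling T) (p : Set (E d) → Prop)
    (hp : ∀ A B, Adjacent T A B → p A → p B) (hA : A ∈ T) (hpA : p A) (hB : B ∈ T) : p B :=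
  hT.forall_of_adjacent isPreconnected_univ p (fun A B h _ => hp A B h) hA
    (by simpa using hT.nonempty hA) hpA hB (by simpa using hT.nonempty hB)

end IsNormalTiling

end Adjacency

section Potential

variable {d : ℕ} {T : Set (Set (E d))} {A B : Set (E d)} {s : Set (E d) → ℝ} {S S' : Set (E d)}
  {x : E d} {f f' : Set (E d) → E d × ℝ}

/-- The affine function on `E d` encoded by the pair of its gradient and its value at the
origin. -/
def affineEval (φ : E d × ℝ) (x : E d) : ℝ := ⟪φ.1, x⟫_ℝ + φ.2

/-- A unit normal to the common facet of `A` and `B`, directed from `A` to `B`. -/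
def unitNormal (A B : Set (E d)) : E d := Classical.epsilon (IsUnitNormal A B)

/-- The affine function with gradient `s (A ∩ B) • n` that vanishes on the common facet of `A` and
`B`: the lift of `B` differs by it from the lift of `A`. -/
def jump (s : Set (E d) → ℝ) (A B : Set (E d)) : E d × ℝ :=
  (s (A ∩ B) • unitNormal A B,
    -(s (A ∩ B) * ⟪unitNormal A B, Classical.epsilon (· ∈ A ∩ B)⟫_ℝ))

/-- The affine functions `f A` differ by the prescribed jumps across all facets that meet `S`. With
`S` a point this is a local lifting of the tiling, with `S` the whole space a global one. -/
def IsPotentialOn (T : Set (Set (E d))) (s : Set (E d) → ℝ) (S : Set (E d))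
    (f : Set (E d) → E d × ℝ) : Prop :=
  ∀ A B, Adjacent T A B → (A ∩ B ∩ S).Nonempty → f B - f A = jump s A B

lemma IsPotentialOn.mono (hf : IsPotentialOn T s S f) (h : S' ⊆ S) : IsPotentialOn T s S' f :=
  fun A B hAB hS => hf A B hAB (hS.mono (Set.inter_subset_inter_right _ h))

lemma IsPotentialOn.sub_const (hf : IsPotentialOn T s S f) (φ : E d × ℝ) :
    IsPotentialOn T s S fun A => f A - φ :=
  fun A B hAB hS => (sub_sub_sub_cancel_right _ _ _).trans (hf A B hAB hS)

namespace IsNormalTiling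

lemma unitNormal_eq (hT : IsNormalTiling T) (h : Adjacent T A B) {n : E d}
    (hn : IsUnitNormal A B n) : unitNormal A B = n :=
  hT.isUnitNormal_unique h (Classical.epsilon_spec ⟨n, hn⟩) hn

lemma jump_eq (hT : IsNormalTiling T) (h : Adjacent T A B) {n w : E d}
    (hn : IsUnitNormal A B n) (hw : w ∈ A ∩ B) :
    jump s A B = (s (A ∩ B) • n, -(s (A ∩ B) * ⟪n, w⟫_ℝ)) := by
  have hmem : Classical.epsilon (· ∈ A ∩ B) ∈ A ∩ B :=
    Classical.epsilon_spec (p := (· ∈ A ∩ B)) ⟨w, hw⟩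
  rw [jump, hT.unitNormal_eq h hn, mem_vectorSpan_orthogonal_iff.1 hn.2.1 _ hmem w hw]

lemma jump_symm (hT : IsNormalTiling T) (h : Adjacent T A B) : jump s B A = -jump s A B := by
  obtain ⟨n, hn⟩ := hT.exists_isUnitNormal h
  obtain ⟨w, hw⟩ := h.nonempty
  rw [hT.jump_eq h hn hw, hT.jump_eq h.symm hn.neg hw.symm, Set.inter_comm B A]
  simp

lemma affineEval_jump (hT : IsNormalTiling T) (h : Adjacent T A B) {n w : E d}
    (hn : IsUnitNormal A B n) (hw : w ∈ A ∩ B) (y : E d) :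
    affineEval (jump s A B) y = s (A ∩ B) * ⟪n, y - w⟫_ℝ := by
  rw [affineEval, hT.jump_eq h hn hw, real_inner_smul_left, inner_sub_right]
  ring

lemma sub_eq_sub_of_isPotentialOn (hT : IsNormalTiling T) (hS : IsPreconnected S)
    (hf : IsPotentialOn T s S f) (hf' : IsPotentialOn T s S f') (hA : A ∈ T)
    (hAS : (S ∩ A).Nonempty) (hB : B ∈ T) (hBS : (S ∩ B).Nonempty) : f B - f' B = f A - f' A := by
  refine hT.forall_of_adjacent hS (fun C => f C - f' C = f A - f' A) (fun C D hCD hne h => ?_)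
    hA hAS rfl hB hBS
  have hjump := (hf C D hCD hne).trans (hf' C D hCD hne).symm
  rw [← h]
  exact sub_eq_sub_iff_sub_eq_sub.1 hjump

lemma exists_isPotentialOn_singleton_of_mem_codimLE_one (hT : IsNormalTiling T)
    (hx : x ∈ codimLE T 1) : ∃ f, IsPotentialOn T s {x} f := by
  classical
  obtain ⟨A₀, hA₀, hxA₀⟩ := hT.exists_mem x
  refine ⟨fun B => if B = A₀ then 0 else jump s A₀ B, ?_⟩
  rintro A B hAB ⟨_, ⟨hxA, hxB⟩, rfl⟩
  rcases hT.eq_or_eq_of_subset hAB hA₀ ⟨_, mem_minFace T _⟩ hx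
    (Set.subset_inter (minFace_subset hAB.1 hxA) (minFace_subset hAB.2.1 hxB))
    (minFace_subset hA₀ hxA₀) with rfl | rfl
  · simp [hAB.2.2.1.symm]
  · simp [hAB.2.2.1, hT.jump_symm hAB]

end IsNormalTiling

end Potential

section Coboundary

variable {K V α β : Type*} [Field K] [AddCommGroup V] [Module K V] {src tgt : β → α}

/-- The coboundary operator of a directed graph with vertex set `α` and edge set `β`: the
differences of a function on the vertices along the edges. -/
def coboundary (K V : Type*) [Field K] [AddCommGroup V] [Module K V] (src tgt : β → α) :
    (α → V) →ₗ[K] (β → V) :=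
  LinearMap.funLeft K V tgt - LinearMap.funLeft K V src

lemma coboundary_apply (f : α → V) (e : β) :
    coboundary K V src tgt f e = f (tgt e) - f (src e) := rfl

lemma finrank_ker_coboundary_le [FiniteDimensional K V] {a : α}
    (hconn : ∀ φ : α → V, (∀ e, φ (tgt e) = φ (src e)) → ∀ b, φ b = φ a) :
    Module.finrank K (LinearMap.ker (coboundary K V src tgt)) ≤ Module.finrank K V := by
  let evalAt : LinearMap.ker (coboundary K V src tgt) →ₗ[K] V :=
    (LinearMap.proj a : (α → V) →ₗ[K] V) ∘ₗ (LinearMap.ker (coboundary K V src tgt)).subtype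
  refine LinearMap.finrank_le_finrank_of_injective (f := evalAt) ?_
  rw [← LinearMap.ker_eq_bot, LinearMap.ker_eq_bot']
  rintro ⟨φ, hφ⟩ (hφa : φ a = 0)
  ext b
  exact (hconn φ (fun e => sub_eq_zero.1 (congrFun (LinearMap.mem_ker.1 hφ) e)) b).trans hφa

lemma card_mul_finrank_le_finrank_range_coboundary [FiniteDimensional K V] [Fintype α] {a : α}
    (hconn : ∀ φ : α → V, (∀ e, φ (tgt e) = φ (src e)) → ∀ b, φ b = φ a) :
    Fintype.card α * Module.finrank K V ≤
      Module.finrank K (LinearMap.range (coboundary K V src tgt)) + Module.finrank K V := by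
  have hrank := (coboundary K V src tgt).finrank_range_add_finrank_ker
  rw [Module.finrank_pi_fintype, Finset.sum_const, Finset.card_univ, smul_eq_mul] at hrank
  exact hrank ▸ Nat.add_le_add_left (finrank_ker_coboundary_le hconn) _

lemma sum_coboundary_eq_zero [Fintype β] (hsrc : Function.Bijective src)
    (htgt : Function.Bijective tgt) (f : α → V) : ∑ e, coboundary K V src tgt f e = 0 := by
  let _ : Fintype α := .ofBijective src hsrc
  simp only [coboundary_apply, Finset.sum_sub_distrib]
  rw [htgt.sum_comp f, hsrc.sum_comp f, sub_self]

lemma finrank_ker_sum_proj [FiniteDimensional K V] [Fintype β] [Nonempty β] :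
    Module.finrank K (LinearMap.ker (∑ e : β, (LinearMap.proj e : (β → V) →ₗ[K] V))) +
      Module.finrank K V = Fintype.card β * Module.finrank K V := by
  classical
  obtain ⟨e⟩ := ‹Nonempty β›
  have hrange : LinearMap.range (∑ e : β, (LinearMap.proj e : (β → V) →ₗ[K] V)) = ⊤ :=
    LinearMap.range_eq_top.2 fun v => ⟨Pi.single e v, by simp [Finset.sum_pi_single']⟩
  have hrank :=
    (∑ e : β, (LinearMap.proj e : (β → V) →ₗ[K] V)).finrank_range_add_finrank_ker
  rw [hrange, finrank_top, Module.finrank_pi_fintype, Finset.sum_const, Finset.card_univ,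
    smul_eq_mul] at hrank
  rw [add_comm, hrank]

/-- The graph is a path or a cycle. For a path the coboundary operator is onto; for a cycle its
range has the dimension of the space of functions with sum zero. -/
lemma exists_sub_eq_of_sum_eq_zero (K : Type*) [Field K] [Module K V] [FiniteDimensional K V]
    [Finite α] [Fintype β] (hsrc : Function.Injective src) (htgt : Function.Injective tgt) (a : α)
    (hconn : ∀ φ : α → V, (∀ e, φ (tgt e) = φ (src e)) → ∀ b, φ b = φ a)
    {w : β → V} (hw : ∑ e, w e = 0) : ∃ f : α → V, ∀ e, f (tgt e) - f (src e) = w e := by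
  cases nonempty_fintype α
  suffices h : w ∈ LinearMap.range (coboundary K V src tgt) by
    obtain ⟨f, rfl⟩ := h
    exact ⟨f, fun _ => rfl⟩
  have hrange := card_mul_finrank_le_finrank_range_coboundary (K := K) hconn
  rcases (Fintype.card_le_of_injective src hsrc).lt_or_eq with hlt | heq
  · suffices h : LinearMap.range (coboundary K V src tgt) = ⊤ from h ▸ Submodule.mem_top
    refine Submodule.eq_top_of_finrank_eq (le_antisymm (Submodule.finrank_le _) ?_)
    rw [Module.finrank_pi_fintype, Finset.sum_const, Finset.card_univ, smul_eq_mul]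
    linarith [Nat.mul_le_mul_right (Module.finrank K V) (Nat.succ_le_of_lt hlt),
      Nat.succ_mul (Fintype.card β) (Module.finrank K V)]
  · have hsrc' := (Fintype.bijective_iff_injective_and_card src).2 ⟨hsrc, heq⟩
    have htgt' := (Fintype.bijective_iff_injective_and_card tgt).2 ⟨htgt, heq⟩
    have : Nonempty β := ⟨(hsrc'.2 a).choose⟩
    have hle : LinearMap.range (coboundary K V src tgt) ≤
        LinearMap.ker (∑ e : β, (LinearMap.proj e : (β → V) →ₗ[K] V)) := by
      rintro _ ⟨f, rfl⟩
      simpa using sum_coboundary_eq_zero (K := K) hsrc' htgt' f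
    have hker := finrank_ker_sum_proj (K := K) (V := V) (β := β)
    rw [Submodule.eq_of_le_of_finrank_le hle (by rw [← heq] at hrange; omega)]
    simpa using hw

end Coboundary

section Plane

variable {N : Type*} [NormedAddCommGroup N] [InnerProductSpace ℝ N] {a b u v : N}

lemma eq_inner_smul_add_inner_smul (hN : Module.finrank ℝ N = 2) (hu : ‖u‖ = 1) (hv : ‖v‖ = 1)
    (huv : ⟪u, v⟫_ℝ = 0) (w : N) : w = ⟪u, w⟫_ℝ • u + ⟪v, w⟫_ℝ • v := by
  have : FiniteDimensional ℝ N := Module.finite_of_finrank_pos (hN ▸ two_pos)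
  have hon : Orthonormal ℝ ![u, v] := by simp [orthonormal_vecCons_iff, hu, hv, huv]
  have hcard : Fintype.card (Fin 2) = Module.finrank ℝ N := by rw [hN, Fintype.card_fin]
  let basis := (basisOfOrthonormalOfCardEqFinrank hon hcard).toOrthonormalBasis
    (by rwa [coe_basisOfOrthonormalOfCardEqFinrank])
  simpa [basis, Fin.sum_univ_two] using (basis.sum_repr' w).symm

lemma eq_or_eq_neg_of_inner_eq_zero (hN : Module.finrank ℝ N = 2) (hu : ‖u‖ = 1) (ha : ‖a‖ = 1)
    (hb : ‖b‖ = 1) (hua : ⟪u, a⟫_ℝ = 0) (hub : ⟪u, b⟫_ℝ = 0) : b = a ∨ b = -a := by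
  have hba := eq_inner_smul_add_inner_smul hN hu ha hua b
  rw [hub, zero_smul, zero_add] at hba
  have habs : |⟪a, b⟫_ℝ| = 1 := by
    rw [← hb, hba, norm_smul, ha, mul_one, Real.norm_eq_abs, ← hba]
  rcases eq_or_eq_neg_of_abs_eq habs with h | h
  · exact Or.inl (by rw [hba, h, one_smul])
  · exact Or.inr (by rw [hba, h, neg_one_smul])

lemma exists_quarterTurn (hN : Module.finrank ℝ N = 2) :
    ∃ J : N →ₗᵢ[ℝ] N, ∀ w, ⟪J w, w⟫_ℝ = 0 := by
  have : Fact (Module.finrank ℝ N = 2) := ⟨hN⟩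
  have : FiniteDimensional ℝ N := Module.finite_of_finrank_pos (hN ▸ two_pos)
  let o : Orientation ℝ N (Fin 2) :=
    ((stdOrthonormalBasis ℝ N).toBasis.reindex (finCongr hN)).orientation
  exact ⟨o.rightAngleRotation.toLinearIsometry, fun w => o.inner_rightAngleRotation_self w⟩

lemma inner_map_eq_neg_of_inner_map_self_eq_zero (J : N →ₗ[ℝ] N) (hJ : ∀ w, ⟪J w, w⟫_ℝ = 0)
    (v w : N) : ⟪J v, w⟫_ℝ = -⟪J w, v⟫_ℝ := by
  have h := hJ (v + w)
  rw [map_add, inner_add_left, inner_add_right, inner_add_right, hJ, hJ] at h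
  linarith

end Plane

section RayDirection

variable {d : ℕ} {R F : Set (E d)} {u m n : normalSpace R} {r y : E d}

lemma finrank_normalSpace (hR : dim R + 2 = d) : Module.finrank ℝ (normalSpace R) = 2 :=
  Nat.add_left_cancel ((dim_add_finrank_orthogonal R).trans hR.symm)

/-- The ray points opposite to the projection to `vectorSpan ℝ F` of a normal supporting `F`
along `R`. -/
lemma exists_isRayDirection (hRF : IsExposed ℝ F R) (hne : R.Nonempty) (hneF : R ≠ F) :
    ∃ u, IsRayDirection R F u := by
  obtain ⟨m, -, hm⟩ := exists_unit_eq_maxFace hRF hne hneF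
  obtain ⟨r₀, hr₀⟩ := hne
  set p : E d := (vectorSpan ℝ F).starProjection m with hp
  have hpF : p ∈ vectorSpan ℝ F := Submodule.starProjection_apply_mem _ _
  have hpm : ∀ v ∈ vectorSpan ℝ F, ⟪p, v⟫_ℝ = ⟪m, v⟫_ℝ := fun v hv => by
    rw [hp, Submodule.inner_starProjection_left_eq_right,
      Submodule.starProjection_eq_self_iff.2 hv]
  have hpR : p ∈ normalSpace R := (Submodule.mem_orthogonal' _ _).2 fun v hv => by
    rw [hpm v (vectorSpan_mono ℝ hRF.subset hv)]
    exact (Submodule.mem_orthogonal' _ _).1 (hm ▸ mem_vectorSpan_maxFace_orthogonal m F) v hv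
  have hle : ∀ y ∈ F, ∀ r ∈ R, ⟪p, y - r⟫_ℝ ≤ 0 := fun y hy r hr => by
    rw [← vsub_eq_sub, hpm _ (vsub_mem_vectorSpan ℝ hy (hRF.subset hr)), vsub_eq_sub,
      inner_sub_right, sub_nonpos]
    exact (hm ▸ hr : r ∈ maxFace m F).2 y hy
  have hp0 : p ≠ 0 := fun h0 => hneF <| hRF.subset.antisymm fun y hy => by
    have hy₀ := hpm _ (vsub_mem_vectorSpan ℝ (hRF.subset hr₀) hy)
    rw [h0, inner_zero_left, vsub_eq_sub, inner_sub_right, eq_comm, sub_eq_zero] at hy₀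
    rw [hm] at hr₀ ⊢
    exact ⟨hy, fun z hz => hy₀ ▸ hr₀.2 z hz⟩
  refine ⟨-(‖p‖⁻¹ • ⟨p, hpR⟩), ?_, ?_, fun y hy r hr => ?_⟩
  · rw [norm_neg, norm_smul, norm_inv, norm_norm]
    exact inv_mul_cancel₀ (norm_ne_zero_iff.2 hp0)
  · exact neg_mem (Submodule.smul_mem _ _ hpF)
  · rw [Submodule.coe_neg, Submodule.coe_smul, inner_neg_left, real_inner_smul_left,
      neg_nonneg]
    exact mul_nonpos_of_nonneg_of_nonpos (by positivity) (hle y hy r hr)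

lemma IsRayDirection.exists_inner_pos (hu : IsRayDirection R F u) (hr : r ∈ R) :
    ∃ y ∈ F, 0 < ⟪(u : E d), y - r⟫_ℝ := by
  by_contra! hcon
  have heq : ∀ y ∈ F, ⟪(u : E d), y⟫_ℝ = ⟪(u : E d), r⟫_ℝ := fun y hy => by
    have := (hcon y hy).antisymm (hu.2.2 y hy r hr)
    rwa [inner_sub_right, sub_eq_zero] at this
  have huF : (u : E d) ∈ (vectorSpan ℝ F)ᗮ :=
    mem_vectorSpan_orthogonal_iff.2 fun y hy z hz => (heq y hy).trans (heq z hz).symm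
  have hu0 : (u : E d) = 0 :=
    inner_self_eq_zero.1 ((Submodule.mem_orthogonal _ _).1 huF _ hu.2.1)
  have hu1 := hu.1
  rw [Submodule.coe_eq_zero.1 hu0, norm_zero] at hu1
  exact zero_ne_one hu1

lemma IsRayDirection.inner_nonpos (hu : IsRayDirection R F u) (hR : dim R + 2 = d)
    (hm : ‖m‖ = 1) (hmF : (m : E d) ∈ (vectorSpan ℝ F)ᗮ) (hr : r ∈ R) (hrF : r ∈ F)
    (hn : ∀ y ∈ F, ⟪(n : E d), y⟫_ℝ ≤ ⟪(n : E d), r⟫_ℝ) : ⟪n, u⟫_ℝ ≤ 0 := by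
  obtain ⟨y, hy, hpos⟩ := hu.exists_inner_pos hr
  have hexpand : (n : E d) = ⟪u, n⟫_ℝ • (u : E d) + ⟪m, n⟫_ℝ • (m : E d) :=
    congrArg Subtype.val <| eq_inner_smul_add_inner_smul (finrank_normalSpace hR) hu.1 hm
      ((Submodule.mem_orthogonal _ _).1 hmF _ hu.2.1) n
  have hmy : ⟪(m : E d), y - r⟫_ℝ = 0 := by
    rw [inner_sub_right, mem_vectorSpan_orthogonal_iff.1 hmF y hy r hrF, sub_self]
  have hny : ⟪(n : E d), y - r⟫_ℝ = ⟪u, n⟫_ℝ * ⟪(u : E d), y - r⟫_ℝ := by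
    rw [hexpand, inner_add_left, real_inner_smul_left, real_inner_smul_left, hmy, mul_zero,
      add_zero]
  rw [real_inner_comm]
  refine nonpos_of_mul_nonpos_left (hny ▸ ?_) hpos
  rw [inner_sub_right]
  exact sub_nonpos.2 (hn y hy)

end RayDirection

section Ridge

variable {d : ℕ} {T : Set (Set (E d))} {A B B' R : Set (E d)}

namespace IsNormalTiling

lemma inter_eq_inter_of_inner_eq_neg (hT : IsNormalTiling T) (hR : dim R + 2 = d)
    (hRne : R.Nonempty) (h : Adjacent T A B) (h' : Adjacent T A B') (hRB : R ⊆ A ∩ B)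
    (hRB' : R ⊆ A ∩ B') {n n' u u' : normalSpace R} (hn : IsUnitNormal A B n)
    (hn' : IsUnitNormal A B' n') (hu : IsRayDirection R (A ∩ B) u)
    (hu' : IsRayDirection R (A ∩ B') u') (hinner : ⟪n, u'⟫_ℝ = -⟪n', u⟫_ℝ) :
    A ∩ B = A ∩ B' := by
  obtain ⟨r, hr⟩ := hRne
  have hnu' := hu'.inner_nonpos hR hn'.1 hn'.2.1 hr (hRB' hr)
    fun y hy => hn.2.2 y hy.1 r (hRB hr).2
  have hn'u := hu.inner_nonpos hR hn.1 hn.2.1 hr (hRB hr)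
    fun y hy => hn'.2.2 y hy.1 r (hRB' hr).2
  have hu'n : ⟪u', n⟫_ℝ = 0 := by rw [real_inner_comm]; linarith
  have hu'n' : ⟪u', n'⟫_ℝ = 0 := (Submodule.mem_orthogonal _ _).1 hn'.2.1 _ hu'.2.1
  rcases eq_or_eq_neg_of_inner_eq_zero (finrank_normalSpace hR) hu'.1 hn'.1 hn.1 hu'n' hu'n
    with heq | heq
  · rw [hT.inter_eq_maxFace h hn, hT.inter_eq_maxFace h' hn', heq]
  · obtain ⟨z, hz⟩ := hT.interior_nonempty h.1
    have hlt := inner_lt_of_mem_interior hn.ne_zero (fun y hy => hn.2.2 y hy r (hRB hr).2) hz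
    have hge := hn'.2.2 z (interior_subset hz) r (hRB' hr).2
    rw [heq, Submodule.coe_neg, inner_neg_left, inner_neg_left] at hlt
    linarith

end IsNormalTiling

end Ridge

section TurnPairs

variable {d : ℕ} {T : Set (Set (E d))} {s : Set (E d) → ℝ} {A B R : Set (E d)} {x : E d}
  {u n : Set (E d) → normalSpace R}

/-- The ordered pairs of tiles whose common facet contains `R` and has the unit normal `n (A ∩ B)`
directed from `A` to `B`. If `n` agrees with a direction of traversal around the ridge `R`, these
are the steps of that traversal. -/
def turnPairs (T : Set (Set (E d))) (R : Set (E d)) (n : Set (E d) → normalSpace R) :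
    Set (Set (E d) × Set (E d)) :=
  {p | Adjacent T p.1 p.2 ∧ R ⊆ p.1 ∩ p.2 ∧ IsUnitNormal p.1 p.2 (n (p.1 ∩ p.2))}

lemma swap_mem_turnPairs_neg (hp : (A, B) ∈ turnPairs T R n) :
    (B, A) ∈ turnPairs T R (-n) := by
  obtain ⟨h, hR, hn⟩ := hp
  refine ⟨h.symm, Set.inter_comm A B ▸ hR, ?_⟩
  simpa only [Pi.neg_apply, Submodule.coe_neg, Set.inter_comm B A] using hn.neg

namespace IsNormalTiling

lemma mem_turnPairs_or_swap_mem (hT : IsNormalTiling T) (hR : dim R + 2 = d)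
    (hu : ∀ F, IsFacet T F → R ⊆ F → IsRayDirection R F (u F)) (hnorm : ∀ F, ‖n F‖ = ‖u F‖)
    (horth : ∀ F, ⟪n F, u F⟫_ℝ = 0) (h : Adjacent T A B) (hRAB : R ⊆ A ∩ B) :
    (A, B) ∈ turnPairs T R n ∨ (B, A) ∈ turnPairs T R n := by
  obtain ⟨m, hm⟩ := hT.exists_isUnitNormal h
  have huAB := hu _ h.2.2.2 hRAB
  let m' : normalSpace R := ⟨m, Submodule.orthogonal_le (vectorSpan_mono ℝ hRAB) hm.2.1⟩
  rcases eq_or_eq_neg_of_inner_eq_zero (b := m') (finrank_normalSpace hR) huAB.1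
    ((hnorm _).trans huAB.1) hm.1 ((real_inner_comm _ _).trans (horth _))
    ((Submodule.mem_orthogonal _ _).1 hm.2.1 _ huAB.2.1) with heq | heq
  · exact Or.inl ⟨h, hRAB, heq ▸ hm⟩
  · refine Or.inr (neg_neg n ▸ swap_mem_turnPairs_neg ⟨h, hRAB, ?_⟩)
    exact (heq ▸ hm : IsUnitNormal A B (-n (A ∩ B) : normalSpace R))

lemma injOn_fst_turnPairs (hT : IsNormalTiling T) (hR : dim R + 2 = d) (hRne : R.Nonempty)
    (hu : ∀ F, IsFacet T F → R ⊆ F → IsRayDirection R F (u F))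
    (hskew : ∀ F F', ⟪n F, u F'⟫_ℝ = -⟪n F', u F⟫_ℝ) :
    Set.InjOn Prod.fst (turnPairs T R n) := by
  rintro ⟨A, B⟩ ⟨h, hRB, hn⟩ ⟨A', B'⟩ ⟨h', hRB', hn'⟩ (hA : A = A')
  obtain rfl := hA
  have hinter : A ∩ B = A ∩ B' := hT.inter_eq_inter_of_inner_eq_neg hR hRne h h' hRB hRB' hn hn'
    (hu _ h.2.2.2 hRB) (hu _ h'.2.2.2 hRB') (hskew _ _)
  exact Prod.ext rfl <| ((hT.eq_or_eq_of_subset h h'.2.1 h.nonempty h.dim_eq.ge subset_rfl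
    (hinter.trans_subset Set.inter_subset_right)).resolve_left h'.2.2.1.symm).symm

lemma injOn_snd_turnPairs (hT : IsNormalTiling T) (hR : dim R + 2 = d) (hRne : R.Nonempty)
    (hu : ∀ F, IsFacet T F → R ⊆ F → IsRayDirection R F (u F))
    (hskew : ∀ F F', ⟪n F, u F'⟫_ℝ = -⟪n F', u F⟫_ℝ) :
    Set.InjOn Prod.snd (turnPairs T R n) := by
  rintro ⟨A, B⟩ hp ⟨A', B'⟩ hp' hB
  refine Prod.swap_injective (hT.injOn_fst_turnPairs (n := -n) hR hRne hu (fun F F' => ?_)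
    (swap_mem_turnPairs_neg hp) (swap_mem_turnPairs_neg hp') hB)
  simp only [Pi.neg_apply, inner_neg_left, hskew F F']

lemma injOn_inter_turnPairs (hT : IsNormalTiling T) :
    Set.InjOn (fun p => p.1 ∩ p.2) (turnPairs T R n) := by
  rintro ⟨A, B⟩ ⟨h, -, hn⟩ ⟨A', B'⟩ hp' (heq : A ∩ B = A' ∩ B')
  have hA' : A' = A ∨ A' = B := hT.eq_or_eq_of_subset h hp'.1.1 h.nonempty h.dim_eq.ge subset_rfl
    (heq.trans_subset Set.inter_subset_left)
  have hB' : B' = A ∨ B' = B := hT.eq_or_eq_of_subset h hp'.1.2.1 h.nonempty h.dim_eq.ge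
    subset_rfl (heq.trans_subset Set.inter_subset_right)
  have hne : A' ≠ B' := hp'.1.2.2.1
  rcases hA' with rfl | rfl
  · rw [hB'.resolve_left hne.symm]
  · rw [hB'.resolve_right hne.symm] at hp'
    have : IsAddTorsionFree (E d) := .of_isTorsionFree ℝ _
    have hself := hT.isUnitNormal_unique h hn (swap_mem_turnPairs_neg hp').2.2
    simp only [Pi.neg_apply, Submodule.coe_neg] at hself
    exact absurd (self_eq_neg.1 hself) hn.ne_zero

lemma bijOn_inter_turnPairs (hT : IsNormalTiling T) (hR : dim R + 2 = d)
    (hu : ∀ F, IsFacet T F → R ⊆ F → IsRayDirection R F (u F)) (hnorm : ∀ F, ‖n F‖ = ‖u F‖)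
    (horth : ∀ F, ⟪n F, u F⟫_ℝ = 0) :
    Set.BijOn (fun p => p.1 ∩ p.2) (turnPairs T R n) {F | IsFacet T F ∧ R ⊆ F} := by
  refine ⟨fun p hp => ⟨hp.1.2.2.2, hp.2.1⟩, hT.injOn_inter_turnPairs, ?_⟩
  rintro F ⟨⟨⟨hne, A, hA, hFA⟩, hd⟩, hRF⟩
  obtain ⟨B, h, rfl⟩ := hT.exists_adjacent_inter_eq hA hFA hne hd
  rcases hT.mem_turnPairs_or_swap_mem hR hu hnorm horth h hRF with hp | hp
  exacts [⟨_, hp, rfl⟩, ⟨_, hp, Set.inter_comm B A⟩]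

lemma finite_turnPairs (hT : IsNormalTiling T) (hRne : R.Nonempty) : (turnPairs T R n).Finite := by
  obtain ⟨x, hx⟩ := hRne
  exact ((hT.finite_mem x).prod (hT.finite_mem x)).subset fun p hp =>
    ⟨⟨hp.1.1, (hp.2.1 hx).1⟩, hp.1.2.1, (hp.2.1 hx).2⟩

lemma finsum_jump_turnPairs (hT : IsNormalTiling T) (hR : dim R + 2 = d)
    {J : normalSpace R →ₗᵢ[ℝ] normalSpace R} (hJ : ∀ w, ⟪J w, w⟫_ℝ = 0)
    (hu : ∀ F, IsFacet T F → R ⊆ F → IsRayDirection R F (u F)) (hx : x ∈ R) :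
    ∑ᶠ p ∈ turnPairs T R (fun F => J (u F)), jump s p.1 p.2 =
      (torsion T s R J u, -⟪torsion T s R J u, x⟫_ℝ) := by
  let graphAt : E d →ₗ[ℝ] E d × ℝ := LinearMap.id.prod (-(innerₗ (E d) x))
  have hgraph : ∀ v, graphAt v = (v, -⟪v, x⟫_ℝ) := fun v => by simp [graphAt, real_inner_comm]
  have hjump : ∀ p ∈ turnPairs T R (fun F => J (u F)),
      jump s p.1 p.2 = graphAt (s (p.1 ∩ p.2) • (J (u (p.1 ∩ p.2)) : E d)) := fun p hp => by
    rw [hT.jump_eq hp.1 hp.2.2 (hp.2.1 hx), hgraph, real_inner_smul_left]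
  rw [finsum_mem_congr rfl hjump, ← hgraph, torsion,
    ← finsum_mem_eq_of_bijOn _ (hT.bijOn_inter_turnPairs hR hu (fun F => J.norm_map _)
      fun F => hJ _) fun _ _ => rfl]
  exact ((graphAt : E d →+ E d × ℝ).map_finsum_mem _ (hT.finite_turnPairs ⟨x, hx⟩)).symm

lemma isPotentialOn_of_forall_turnPairs (hT : IsNormalTiling T) {f : Set (E d) → E d × ℝ}
    (hpairs : ∀ A B, Adjacent T A B → x ∈ A ∩ B →
      (A, B) ∈ turnPairs T R n ∨ (B, A) ∈ turnPairs T R n)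
    (hf : ∀ p ∈ turnPairs T R n, f p.2 - f p.1 = jump s p.1 p.2) : IsPotentialOn T s {x} f := by
  rintro A B h ⟨_, hAB, rfl⟩
  rcases hpairs A B h hAB with hp | hp
  · exact hf _ hp
  · rw [← neg_sub, hf _ hp, hT.jump_symm h, neg_neg]

lemma eq_of_forall_turnPairs_eq (hT : IsNormalTiling T) {α : Type*} {φ : Set (E d) → α}
    (hpairs : ∀ A B, Adjacent T A B → x ∈ A ∩ B →
      (A, B) ∈ turnPairs T R n ∨ (B, A) ∈ turnPairs T R n)
    (hφ : ∀ p ∈ turnPairs T R n, φ p.2 = φ p.1) (hA : A ∈ T) (hxA : x ∈ A) (hB : B ∈ T)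
    (hxB : x ∈ B) : φ B = φ A := by
  refine hT.forall_mem_of_adjacent (fun C => φ C = φ A) (fun C D h hxCD hC => ?_)
    hA hxA rfl hB hxB
  rcases hpairs C D h hxCD with hp | hp
  exacts [(hφ _ hp).trans hC, (hφ _ hp).symm.trans hC]

/-- The tiles around `R` form the vertices of a graph, with the steps of a traversal as edges. -/
lemma exists_isPotentialOn_of_finsum_jump_eq_zero (hT : IsNormalTiling T) (hR : dim R + 2 = d)
    (hu : ∀ F, IsFacet T F → R ⊆ F → IsRayDirection R F (u F)) (hnorm : ∀ F, ‖n F‖ = ‖u F‖)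
    (hskew : ∀ F F', ⟪n F, u F'⟫_ℝ = -⟪n F', u F⟫_ℝ) (hx : x ∈ R)
    (hRx : ∀ A ∈ T, x ∈ A → R ⊆ A) (hsum : ∑ᶠ p ∈ turnPairs T R n, jump s p.1 p.2 = 0) :
    ∃ f, IsPotentialOn T s {x} f := by
  have : Fintype {A ∈ T | x ∈ A} := (hT.finite_mem x).fintype
  have : Fintype (turnPairs T R n) := (hT.finite_turnPairs ⟨x, hx⟩).fintype
  let src (p : turnPairs T R n) : {A ∈ T | x ∈ A} := ⟨p.1.1, p.2.1.1, (p.2.2.1 hx).1⟩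
  let tgt (p : turnPairs T R n) : {A ∈ T | x ∈ A} := ⟨p.1.2, p.2.1.2.1, (p.2.2.1 hx).2⟩
  have hsrc : Function.Injective src := fun p q hpq => Subtype.ext <|
    hT.injOn_fst_turnPairs hR ⟨x, hx⟩ hu hskew p.2 q.2 (congrArg Subtype.val hpq)
  have htgt : Function.Injective tgt := fun p q hpq => Subtype.ext <|
    hT.injOn_snd_turnPairs hR ⟨x, hx⟩ hu hskew p.2 q.2 (congrArg Subtype.val hpq)
  have hpairs : ∀ A B, Adjacent T A B → x ∈ A ∩ B →
      (A, B) ∈ turnPairs T R n ∨ (B, A) ∈ turnPairs T R n := fun A B h hAB =>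
    hT.mem_turnPairs_or_swap_mem hR hu hnorm (fun F => self_eq_neg.1 (hskew F F)) h
      (Set.subset_inter (hRx A h.1 hAB.1) (hRx B h.2.1 hAB.2))
  let extend (φ : {A ∈ T | x ∈ A} → E d × ℝ) : Set (E d) → E d × ℝ :=
    Function.extend Subtype.val φ 0
  have extend_coe : ∀ φ a, extend φ (a : {A ∈ T | x ∈ A}) = φ a := fun φ a =>
    Subtype.val_injective.extend_apply φ 0 a
  have hconn : ∀ φ : {A ∈ T | x ∈ A} → E d × ℝ, (∀ p, φ (tgt p) = φ (src p)) →
      ∀ a b, φ b = φ a := fun φ hφ a b => by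
    rw [← extend_coe φ a, ← extend_coe φ b]
    refine hT.eq_of_forall_turnPairs_eq hpairs (fun p hp => ?_) a.2.1 a.2.2 b.2.1 b.2.2
    exact (extend_coe φ (tgt ⟨p, hp⟩)).trans ((hφ ⟨p, hp⟩).trans (extend_coe φ (src ⟨p, hp⟩)).symm)
  obtain ⟨A₀, hA₀⟩ := hT.exists_mem x
  obtain ⟨f, hf⟩ := exists_sub_eq_of_sum_eq_zero ℝ hsrc htgt ⟨A₀, hA₀⟩ (hconn · · _)
    (w := fun p => jump s p.1.1 p.1.2) (by
      rwa [← finsum_eq_sum_of_fintype,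
        finsum_set_coe_eq_finsum_mem (f := fun p => jump s p.1 p.2) (turnPairs T R n)])
  refine ⟨extend f, hT.isPotentialOn_of_forall_turnPairs hpairs fun p hp => ?_⟩
  exact (congrArg₂ _ (extend_coe f (tgt ⟨p, hp⟩)) (extend_coe f (src ⟨p, hp⟩))).trans (hf ⟨p, hp⟩)

end IsNormalTiling

end TurnPairs

section LocalPotential

variable {d : ℕ} {T : Set (Set (E d))} {s : Set (E d) → ℝ} {F : Set (E d)} {x : E d}

namespace IsNormalTiling

lemma exists_isRayDirection_minFace (hT : IsNormalTiling T) (hx : dim (minFace T x) + 2 = d)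
    (hF : IsFacet T F) (hxF : minFace T x ⊆ F) : ∃ u, IsRayDirection (minFace T x) F u := by
  obtain ⟨⟨-, A, hA, hFA⟩, hd⟩ := hF
  refine exists_isRayDirection ((hT.isExposed_minFace hA (hFA.subset (hxF (mem_minFace T x)))).mono
    hFA.subset hxF) ⟨x, mem_minFace T x⟩ ?_
  rintro rfl
  omega

lemma exists_isPotentialOn_singleton_of_isRidge (hT : IsNormalTiling T)
    (hs : IsCanonicalScaling T s) (hx : IsRidge T (minFace T x)) :
    ∃ f, IsPotentialOn T s {x} f := by
  obtain ⟨J, hJ⟩ := exists_quarterTurn (finrank_normalSpace hx.2)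
  have hray : ∀ F, ∃ u, IsFacet T F → minFace T x ⊆ F → IsRayDirection (minFace T x) F u :=
    fun F => by
      by_cases hF : IsFacet T F ∧ minFace T x ⊆ F
      · obtain ⟨u, hu⟩ := hT.exists_isRayDirection_minFace hx.2 hF.1 hF.2
        exact ⟨u, fun _ _ => hu⟩
      · exact ⟨0, fun h h' => absurd ⟨h, h'⟩ hF⟩
  choose u hu using hray
  refine hT.exists_isPotentialOn_of_finsum_jump_eq_zero hx.2 hu (fun F => J.norm_map (u F))
    (fun F F' => inner_map_eq_neg_of_inner_map_self_eq_zero J.toLinearMap hJ _ _)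
    (mem_minFace T x) (fun A hA hxA => minFace_subset hA hxA) ?_
  rw [hT.finsum_jump_turnPairs hx.2 hJ hu (mem_minFace T x), hs.torsion_eq_zero _ hx J hJ u hu,
    inner_zero_left, neg_zero, Prod.mk_zero_zero]

lemma exists_isPotentialOn_singleton (hT : IsNormalTiling T) (hs : IsCanonicalScaling T s)
    (hx : x ∈ codimLE T 2) : ∃ f, IsPotentialOn T s {x} f := by
  by_cases h : x ∈ codimLE T 1
  · exact hT.exists_isPotentialOn_singleton_of_mem_codimLE_one h
  · obtain ⟨A, hA, hxA⟩ := hT.exists_mem x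
    have hd : d ≤ dim (minFace T x) + 2 := hx
    have hd' : ¬d ≤ dim (minFace T x) + 1 := h
    exact hT.exists_isPotentialOn_singleton_of_isRidge hs
      ⟨⟨⟨x, mem_minFace T x⟩, A, hA, hT.isExposed_minFace hA hxA⟩, by omega⟩

end IsNormalTiling

end LocalPotential

/-! ### From local to global liftings -/

section GlobalPotential

variable {d : ℕ} {T : Set (Set (E d))} {A B P₀ : Set (E d)} {s : Set (E d) → ℝ}
  {S S₁ S₂ : Set (E d)} {x p z : E d} {f g : Set (E d) → E d × ℝ} {l : E d → ℝ}

lemma isPotentialOn_iff_forall_singleton :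
    IsPotentialOn T s S f ↔ ∀ x ∈ S, IsPotentialOn T s {x} f :=
  ⟨fun h _ hx => h.mono (Set.singleton_subset_iff.2 hx),
    fun h A B hAB ⟨x, hxAB, hxS⟩ => h x hxS A B hAB ⟨x, hxAB, rfl⟩⟩

namespace IsNormalTiling

lemma isOpen_isPotentialOn_singleton (hT : IsNormalTiling T) (f : Set (E d) → E d × ℝ) :
    IsOpen {x | IsPotentialOn T s {x} f} := by
  refine isOpen_iff_eventually.2 fun x hx => ?_
  filter_upwards [hT.eventually_mem_of_mem x] with y hy
  rintro A B hAB ⟨_, ⟨hyA, hyB⟩, rfl⟩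
  exact hx A B hAB ⟨x, ⟨hy A hAB.1 hyA, hy B hAB.2.1 hyB⟩, rfl⟩

lemma exists_forall_eq_add_of_isPotentialOn (hT : IsNormalTiling T) (hS : IsPreconnected S)
    (hf : IsPotentialOn T s S f) (hg : IsPotentialOn T s S g) :
    ∃ φ, ∀ A ∈ T, (S ∩ A).Nonempty → f A = g A + φ := by
  rcases S.eq_empty_or_nonempty with rfl | ⟨x, hxS⟩
  · exact ⟨0, fun A _ h => absurd h (by simp)⟩
  obtain ⟨A₀, hA₀, hxA₀⟩ := hT.exists_mem x
  refine ⟨f A₀ - g A₀, fun A hA hAS => ?_⟩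
  rw [← hT.sub_eq_sub_of_isPotentialOn hS hf hg hA₀ ⟨x, hxS, hxA₀⟩ hA hAS, add_sub_cancel]

lemma exists_isPotentialOn_union (hT : IsNormalTiling T) (h₁ : IsClosed S₁) (h₂ : IsClosed S₂)
    (hunion : Convex ℝ (S₁ ∪ S₂)) (hinter : IsPreconnected (S₁ ∩ S₂))
    (hf : IsPotentialOn T s S₁ f) (hg : IsPotentialOn T s S₂ g) :
    ∃ F, IsPotentialOn T s (S₁ ∪ S₂) F := by
  classical
  obtain ⟨φ, hφ⟩ := hT.exists_forall_eq_add_of_isPotentialOn hinter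
    (hf.mono Set.inter_subset_left) (hg.mono Set.inter_subset_right)
  have hmeet : ∀ A ∈ T, (S₁ ∩ A).Nonempty → (S₂ ∩ A).Nonempty → (S₁ ∩ S₂ ∩ A).Nonempty := by
    rintro A hA ⟨x, hx, hxA⟩ ⟨y, hy, hyA⟩
    obtain ⟨z, ⟨-, hzA⟩, hz⟩ := isPreconnected_closed_iff.1
      (hunion.inter (hT.convex hA)).isPreconnected S₁ S₂ h₁ h₂ Set.inter_subset_left
      ⟨x, ⟨Or.inl hx, hxA⟩, hx⟩ ⟨y, ⟨Or.inr hy, hyA⟩, hy⟩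
    exact ⟨z, hz, hzA⟩
  let F : Set (E d) → E d × ℝ := fun A => if (S₁ ∩ A).Nonempty then f A else g A + φ
  have hF₁ : ∀ A, (S₁ ∩ A).Nonempty → F A = f A := fun A h => if_pos h
  have hF₂ : ∀ A ∈ T, (S₂ ∩ A).Nonempty → F A = g A + φ := fun A hA h => by
    by_cases h' : (S₁ ∩ A).Nonempty
    · rw [hF₁ A h', hφ A hA (hmeet A hA h' h)]
    · exact if_neg h'
  refine ⟨F, ?_⟩
  rintro A B hAB ⟨x, ⟨hxA, hxB⟩, hxS | hxS⟩
  · rw [hF₁ A ⟨x, hxS, hxA⟩, hF₁ B ⟨x, hxS, hxB⟩]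
    exact hf A B hAB ⟨x, ⟨hxA, hxB⟩, hxS⟩
  · rw [hF₂ A hAB.1 ⟨x, hxS, hxA⟩, hF₂ B hAB.2.1 ⟨x, hxS, hxB⟩, add_sub_add_right_eq_sub]
    exact hg A B hAB ⟨x, ⟨hxA, hxB⟩, hxS⟩

lemma exists_isOpen_isPotentialOn_inter_preimage (hT : IsNormalTiling T) (hS : IsCompact S)
    (hl : Continuous l) {a : ℝ} (hf : IsPotentialOn T s (S ∩ l ⁻¹' {a}) f) :
    ∃ O, IsOpen O ∧ a ∈ O ∧ IsPotentialOn T s (S ∩ l ⁻¹' O) f := by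
  refine ⟨(l '' (S \ {x | IsPotentialOn T s {x} f}))ᶜ,
    ((hS.diff (hT.isOpen_isPotentialOn_singleton f)).image hl).isClosed.isOpen_compl, ?_, ?_⟩
  · rintro ⟨x, ⟨hxS, hx⟩, hxa⟩
    exact hx (isPotentialOn_iff_forall_singleton.1 hf x ⟨hxS, hxa⟩)
  · refine isPotentialOn_iff_forall_singleton.2 fun x hx => ?_
    by_contra hcon
    exact hx.2 ⟨x, ⟨hx.1, hcon⟩, rfl⟩

lemma exists_isPotentialOn_inter_preimage_Icc (hT : IsNormalTiling T) (hS : Convex ℝ S)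
    (hSc : IsClosed S) (l : E d →L[ℝ] ℝ) {O : ℝ → Set ℝ} (hO : ∀ a, IsOpen (O a))
    (haO : ∀ a, a ∈ O a) (hf : ∀ a, ∃ f, IsPotentialOn T s (S ∩ l ⁻¹' O a) f) {a b : ℝ}
    (hab : a ≤ b) : ∃ f, IsPotentialOn T s (S ∩ l ⁻¹' Set.Icc a b) f := by
  have hclosed : ∀ u v, IsClosed (S ∩ l ⁻¹' Set.Icc u v) := fun u v =>
    hSc.inter (isClosed_Icc.preimage l.continuous)
  have hconvex : ∀ u v, Convex ℝ (S ∩ l ⁻¹' Set.Icc u v) := fun u v =>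
    hS.inter ((convex_Icc u v).linear_preimage l.toLinearMap)
  obtain ⟨t, ht₀, ht_mono, ⟨m, hm⟩, ht⟩ := exists_monotone_Icc_subset_open_cover_Icc hab
    (c := fun c => Subtype.val ⁻¹' O c) (fun c => (hO c).preimage continuous_subtype_val)
    fun c _ => Set.mem_iUnion.2 ⟨c, haO c⟩
  have hpiece : ∀ n, ∃ f, IsPotentialOn T s (S ∩ l ⁻¹' Set.Icc (t n) (t (n + 1))) f := fun n => by
    obtain ⟨i, hi⟩ := ht n
    obtain ⟨f, hf⟩ := hf i
    exact ⟨f, hf.mono fun x hx => ⟨hx.1, @hi ⟨l x, (t n).2.1.trans hx.2.1,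
      hx.2.2.trans (t (n + 1)).2.2⟩ hx.2⟩⟩
  have hinit : ∀ n, ∃ f, IsPotentialOn T s (S ∩ l ⁻¹' Set.Icc a (t n)) f := fun n => by
    induction n with
    | zero =>
      obtain ⟨f, hf⟩ := hf a
      refine ⟨f, hf.mono fun x hx => ⟨hx.1, ?_⟩⟩
      have hxa : l x = a := le_antisymm (ht₀ ▸ hx.2.2) hx.2.1
      exact Set.mem_preimage.2 (hxa ▸ haO a)
    | succ n ih =>
      obtain ⟨f, hf⟩ := ih
      obtain ⟨g, hg⟩ := hpiece n
      have hle : (t n : ℝ) ≤ t (n + 1) := ht_mono n.le_succ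
      have hunion : S ∩ l ⁻¹' Set.Icc a (t n) ∪ S ∩ l ⁻¹' Set.Icc (t n) (t (n + 1)) =
          S ∩ l ⁻¹' Set.Icc a (t (n + 1)) := by
        rw [← Set.inter_union_distrib_left, ← Set.preimage_union,
          Set.Icc_union_Icc_eq_Icc (t n).2.1 hle]
      rw [← hunion]
      exact hT.exists_isPotentialOn_union (hclosed _ _) (hclosed _ _) (hunion ▸ hconvex _ _)
        ((hconvex _ _).inter (hconvex _ _)).isPreconnected hf hg
  simpa only [hm m le_rfl] using hinit m

lemma exists_isPotentialOn_of_slices (hT : IsNormalTiling T) (hS : Convex ℝ S)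
    (hSc : IsCompact S) (l : E d →L[ℝ] ℝ)
    (h : ∀ a, ∃ f, IsPotentialOn T s (S ∩ l ⁻¹' {a}) f) : ∃ f, IsPotentialOn T s S f := by
  choose f hf using h
  choose O hO haO hfO using fun a =>
    hT.exists_isOpen_isPotentialOn_inter_preimage hSc l.continuous (hf a)
  obtain ⟨R, hR⟩ := (hSc.image l.continuous).isBounded.subset_closedBall 0
  rw [Real.closedBall_eq_Icc, zero_sub, zero_add, Set.image_subset_iff] at hR
  rcases S.eq_empty_or_nonempty with rfl | ⟨x, hx⟩
  · exact ⟨0, fun A B _ h => absurd h (by simp)⟩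
  · rw [← Set.inter_eq_left.2 hR]
    exact hT.exists_isPotentialOn_inter_preimage_Icc hS hSc.isClosed l hO haO
      (fun a => ⟨f a, hfO a⟩) ((hR hx).1.trans (hR hx).2)

lemma exists_isPotentialOn_of_convex (hT : IsNormalTiling T) (hs : IsCanonicalScaling T s)
    (hS : Convex ℝ S) (hSc : IsCompact S) (hgood : S ⊆ codimLE T 2) :
    ∃ f, IsPotentialOn T s S f := by
  induction hk : dim S using Nat.strong_induction_on generalizing S with
  | _ k ih =>
    by_cases hne : S.Nontrivial
    · obtain ⟨x, hx, y, hy, hxy⟩ := hne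
      let l : E d →L[ℝ] ℝ := innerSL ℝ (y - x)
      refine hT.exists_isPotentialOn_of_slices hS hSc l fun a => ih _ (hk ▸ ?_)
        (hS.inter ((convex_singleton a).linear_preimage l.toLinearMap))
        (hSc.inter_right (isClosed_singleton.preimage l.continuous))
        (Set.inter_subset_left.trans hgood) rfl
      refine Submodule.finrank_lt_finrank_of_lt ((vectorSpan_mono ℝ Set.inter_subset_left).lt_of_ne
        fun heq => hxy (sub_eq_zero.1 (inner_self_eq_zero (𝕜 := ℝ).1 ?_)).symm)
      have hperp : y - x ∈ (vectorSpan ℝ (S ∩ l ⁻¹' {a}))ᗮ :=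
        mem_vectorSpan_orthogonal_iff.2 fun u hu v hv => hu.2.trans hv.2.symm
      exact (Submodule.mem_orthogonal _ _).1 hperp _ (heq ▸ vsub_mem_vectorSpan ℝ hy hx)
    · rcases (Set.not_nontrivial_iff.1 hne).eq_empty_or_singleton with rfl | ⟨x, rfl⟩
      · exact ⟨0, fun A B _ h => absurd h (by simp)⟩
      · exact hT.exists_isPotentialOn_singleton hs (hgood rfl)

lemma exists_isPotentialOn_eq_zero (hT : IsNormalTiling T) (hs : IsCanonicalScaling T s)
    (hS : Convex ℝ S) (hSc : IsCompact S) (hgood : S ⊆ codimLE T 2) (P₀ : Set (E d)) :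
    ∃ f, f P₀ = 0 ∧ IsPotentialOn T s S f := by
  obtain ⟨f, hf⟩ := hT.exists_isPotentialOn_of_convex hs hS hSc hgood
  exact ⟨_, sub_self _, hf.sub_const (f P₀)⟩

lemma eq_of_isPotentialOn_segment (hT : IsNormalTiling T) (hP₀ : P₀ ∈ T) (hp : p ∈ P₀)
    (hS : Convex ℝ S) (hpS : p ∈ S) (hzS : z ∈ S) (hg : IsPotentialOn T s S g) (hg₀ : g P₀ = 0)
    (hf : IsPotentialOn T s (segment ℝ p z) f) (hf₀ : f P₀ = 0) (hA : A ∈ T) (hzA : z ∈ A) :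
    g A = f A := by
  have h := hT.sub_eq_sub_of_isPotentialOn (convex_segment p z).isPreconnected
    (hg.mono (hS.segment_subset hpS hzS)) hf hP₀ ⟨p, left_mem_segment ℝ p z, hp⟩ hA
    ⟨z, right_mem_segment ℝ p z, hzA⟩
  rwa [hg₀, hf₀, sub_zero, sub_eq_zero] at h

lemma mem_codimLE_of_mem_interior (hT : IsNormalTiling T) (hA : A ∈ T) (hx : x ∈ interior A)
    (k : ℕ) : x ∈ codimLE T k := by
  have hAface : A ⊆ minFace T x := fun y hy B hB => hT.eq_of_mem_interior hB.1 hA hB.2 hx ▸ hy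
  exact (dim_eq_of_interior_nonempty ⟨x, hx⟩).symm.trans_le
    ((dim_mono hAface).trans (Nat.le_add_right _ k))

lemma exists_mem_forall_triangle_subset_codimLE (hT : IsNormalTiling T) {Z : Set (E d)}
    (hZ : Z.Countable) (hgood : ∀ z ∈ Z, segment ℝ p z ⊆ codimLE T 2) {O : Set (E d)}
    (hO : IsOpen O) (hne : O.Nonempty) :
    ∃ y ∈ O, ∀ z ∈ Z, convexHull ℝ {p, z, y} ⊆ codimLE T 2 := by
  obtain ⟨y, hyO, hy⟩ := hT.exists_mem_forall_segment_mem_codimLE (hZ.image (segment ℝ p))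
    (j := 1) (by
      rintro _ ⟨z, -, rfl⟩
      rw [← convexHull_pair, dim, ← direction_affineSpan, affineSpan_convexHull,
        direction_affineSpan]
      exact collinear_iff_finrank_le_one.1 (collinear_pair ℝ p z)) hO hne
  refine ⟨y, hyO, fun z hz w hw => ?_⟩
  have hperm : ({p, z, y} : Set (E d)) = {y, p, z} := by
    rw [Set.pair_comm z y, Set.insert_comm]
  rw [hperm, convexHull_insert (Set.insert_nonempty _ _), convexHull_pair,
    convexJoin_singleton_left,
    Set.mem_iUnion₂] at hw
  obtain ⟨q, hq, hwq⟩ := hw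
  by_cases hwq' : w = q
  · exact hwq' ▸ hgood z hz hq
  · exact hy _ ⟨z, hz, rfl⟩ q hq w (segment_symm ℝ y q ▸ hwq) hwq'

lemma exists_isPotentialOn_triangle (hT : IsNormalTiling T) (hs : IsCanonicalScaling T s)
    (hP₀ : P₀ ∈ T) (hp : p ∈ P₀) {F : E d → Set (E d) → E d × ℝ}
    (hF : ∀ z, segment ℝ p z ⊆ codimLE T 2 → F z P₀ = 0 ∧ IsPotentialOn T s (segment ℝ p z) (F z))
    {x y : E d} (hxy : convexHull ℝ {p, x, y} ⊆ codimLE T 2) :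
    ∃ g, IsPotentialOn T s (convexHull ℝ {p, x, y}) g ∧
      ∀ z ∈ ({x, y} : Set (E d)), ∀ C ∈ T, z ∈ C → g C = F z C := by
  obtain ⟨g, hg₀, hg⟩ := hT.exists_isPotentialOn_eq_zero hs (convex_convexHull ℝ {p, x, y})
    ((Set.toFinite {p, x, y}).isCompact_convexHull ℝ) hxy P₀
  refine ⟨g, hg, fun z hz C hC hzC => ?_⟩
  have hz' : z ∈ ({p, x, y} : Set (E d)) := Set.mem_insert_of_mem p hz
  obtain ⟨h₀, h⟩ := hF z ((segment_subset_convexHull (by simp) hz').trans hxy)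
  exact hT.eq_of_isPotentialOn_segment hP₀ hp (convex_convexHull ℝ _)
    (subset_convexHull ℝ _ (by simp)) (subset_convexHull ℝ _ hz') hg hg₀ h h₀ hC hzC

/-- The triangles `p a x`, `p x y` and `p y b` carry potentials, where `x` and `y` are generic
points of `A` and `B` whose segment crosses the common facet. -/
lemma sub_eq_jump_of_isPotentialOn_segment (hT : IsNormalTiling T) (hs : IsCanonicalScaling T s)
    (hP₀ : P₀ ∈ T) (hp : p ∈ P₀) {F : E d → Set (E d) → E d × ℝ}
    (hF : ∀ z, segment ℝ p z ⊆ codimLE T 2 → F z P₀ = 0 ∧ IsPotentialOn T s (segment ℝ p z) (F z))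
    (hAB : Adjacent T A B) {a b : E d} (ha : a ∈ A) (hb : b ∈ B)
    (hpa : segment ℝ p a ⊆ codimLE T 2) (hpb : segment ℝ p b ⊆ codimLE T 2) :
    F b B - F a A = jump s A B := by
  obtain ⟨w, ⟨hwA, hwB⟩, hw⟩ := hT.exists_union_mem_nhds hAB
  obtain ⟨ε, hε, hball⟩ := Metric.mem_nhds_iff.1 hw
  have hwε := Metric.mem_ball_self (x := w) hε
  obtain ⟨x, ⟨hxA, hxε⟩, hx⟩ := hT.exists_mem_forall_triangle_subset_codimLE
    (Set.countable_singleton a) (by simpa using hpa) (isOpen_interior.inter Metric.isOpen_ball)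
    (hT.interior_inter_nonempty hAB.1 Metric.isOpen_ball ⟨w, hwA, hwε⟩)
  have hpx : segment ℝ p x ⊆ codimLE T 2 :=
    (segment_subset_convexHull (by simp) (by simp)).trans (hx a rfl)
  obtain ⟨y, ⟨hyB, hyε⟩, hy⟩ := hT.exists_mem_forall_triangle_subset_codimLE (p := p)
    (Set.countable_insert.2 (Set.countable_singleton x) : ({b, x} : Set (E d)).Countable)
    (by simp [hpb, hpx]) (isOpen_interior.inter Metric.isOpen_ball)
    (hT.interior_inter_nonempty hAB.2.1 Metric.isOpen_ball ⟨w, hwB, hwε⟩)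
  replace hxA := interior_subset hxA
  replace hyB := interior_subset hyB
  obtain ⟨gA, -, hgA⟩ := hT.exists_isPotentialOn_triangle hs hP₀ hp hF (hx a rfl)
  obtain ⟨gB, -, hgB⟩ := hT.exists_isPotentialOn_triangle hs hP₀ hp hF (hy b (by simp))
  obtain ⟨g, hg, hgF⟩ := hT.exists_isPotentialOn_triangle hs hP₀ hp hF (hy x (by simp))
  obtain ⟨z, hz, hzAB⟩ := isPreconnected_closed_iff.1 (convex_segment x y).isPreconnected A B
    (hT.isClosed hAB.1) (hT.isClosed hAB.2.1)
    (((convex_ball w ε).segment_subset hxε hyε).trans hball)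
    ⟨x, left_mem_segment ℝ x y, hxA⟩ ⟨y, right_mem_segment ℝ x y, hyB⟩
  rw [← hg A B hAB ⟨z, hzAB, segment_subset_convexHull (by simp) (by simp) hz⟩,
    hgF y (by simp) B hAB.2.1 hyB, hgF x (by simp) A hAB.1 hxA,
    ← hgA x (by simp) A hAB.1 hxA, hgA a (by simp) A hAB.1 ha,
    ← hgB y (by simp) B hAB.2.1 hyB, hgB b (by simp) B hAB.2.1 hb]

theorem exists_isPotentialOn_univ (hT : IsNormalTiling T) (hs : IsCanonicalScaling T s)
    (hP₀ : P₀ ∈ T) : ∃ Φ, Φ P₀ = 0 ∧ IsPotentialOn T s Set.univ Φ := by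
  obtain ⟨p, hp⟩ := hT.interior_nonempty hP₀
  have hpgood : p ∈ codimLE T 2 := hT.mem_codimLE_of_mem_interior hP₀ hp 2
  have hsegment : ∀ z, ∃ f, segment ℝ p z ⊆ codimLE T 2 →
      f P₀ = 0 ∧ IsPotentialOn T s (segment ℝ p z) f := fun z => by
    by_cases hz : segment ℝ p z ⊆ codimLE T 2
    · obtain ⟨f, hf⟩ := hT.exists_isPotentialOn_eq_zero hs (convex_segment p z)
        (convexHull_pair (𝕜 := ℝ) p z ▸ (Set.toFinite _).isCompact_convexHull ℝ) hz P₀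
      exact ⟨f, fun _ => hf⟩
    · exact ⟨0, fun h => absurd h hz⟩
  choose F hF using hsegment
  have hpoint : ∀ A ∈ T, ∃ a ∈ A, segment ℝ p a ⊆ codimLE T 2 := fun A hA => by
    obtain ⟨a, ha, htri⟩ := hT.exists_mem_forall_triangle_subset_codimLE (p := p)
      (Set.countable_singleton p) (by simpa using hpgood) isOpen_interior (hT.interior_nonempty hA)
    exact ⟨a, interior_subset ha, (segment_subset_convexHull (by simp) (by simp)).trans
      (htri p rfl)⟩
  choose! a ha hpa using hpoint
  exact ⟨fun A => F (a A) A, (hF _ (hpa P₀ hP₀)).1, fun A B hAB _ =>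
    hT.sub_eq_jump_of_isPotentialOn_segment hs hP₀ (interior_subset hp) hF hAB (ha A hAB.1)
      (ha B hAB.2.1) (hpa A hAB.1) (hpa B hAB.2.1)⟩

end IsNormalTiling

end GlobalPotential

/-! ### Convexity of the lifting -/

section Convexity

variable {d : ℕ} {T : Set (Set (E d))} {A B C : Set (E d)} {s : Set (E d) → ℝ}
  {Φ : Set (E d) → E d × ℝ} {x y : E d}

lemma affineEval_sub (φ ψ : E d × ℝ) (x : E d) :
    affineEval (φ - ψ) x = affineEval φ x - affineEval ψ x := by
  simp only [affineEval, Prod.fst_sub, Prod.snd_sub, inner_sub_left]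
  ring

lemma IsPotentialOn.sub_eq_jump (hΦ : IsPotentialOn T s Set.univ Φ) (h : Adjacent T A B) :
    Φ B - Φ A = jump s A B :=
  hΦ A B h (by simpa using h.nonempty)

namespace IsNormalTiling

lemma affineEval_sub_affineEval (hT : IsNormalTiling T) (hΦ : IsPotentialOn T s Set.univ Φ)
    (h : Adjacent T A B) {n w : E d} (hn : IsUnitNormal A B n) (hw : w ∈ A ∩ B) (x : E d) :
    affineEval (Φ B) x - affineEval (Φ A) x = s (A ∩ B) * ⟪n, x - w⟫_ℝ := by
  rw [← affineEval_sub, hΦ.sub_eq_jump h, hT.affineEval_jump h hn hw]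

lemma affineEval_eq_of_mem (hT : IsNormalTiling T) (hΦ : IsPotentialOn T s Set.univ Φ)
    (hA : A ∈ T) (hB : B ∈ T) (hxA : x ∈ A) (hxB : x ∈ B) :
    affineEval (Φ B) x = affineEval (Φ A) x := by
  refine hT.forall_mem_of_adjacent (fun C => affineEval (Φ C) x = affineEval (Φ A) x)
    (fun C D hCD hx h => ?_) hA hxA rfl hB hxB
  obtain ⟨n, hn⟩ := hT.exists_isUnitNormal hCD
  have hsub := hT.affineEval_sub_affineEval hΦ hCD hn hx x
  rw [sub_self, inner_zero_right, mul_zero, sub_eq_zero] at hsub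
  exact hsub.trans h

/-- Here `w` is the last point of `C` on the way to `x`, and `z` is a point just behind `w`. -/
lemma exists_adjacent_of_notMem (hT : IsNormalTiling T)
    (hxy : ∀ w ∈ segment ℝ x y, w ≠ x → w ∈ codimLE T 1) (hC : C ∈ T)
    (hCxy : (C ∩ segment ℝ x y).Nonempty) (hxC : x ∉ C) :
    ∃ D, Adjacent T C D ∧ ∃ w ∈ C ∩ D, ∃ z ∈ D \ C, z ∈ segment ℝ x y ∧
      ∃ r : ℝ, 0 < r ∧ x - w = r • (z - w) := by
  set γ : ℝ → E d := ⇑(AffineMap.lineMap y x : ℝ →ᵃ[ℝ] E d) with hγ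
  have hγ_cont : Continuous γ := AffineMap.lineMap_continuous
  have hγ_sub : ∀ t u, γ t - γ u = (t - u) • (x - y) := fun t u => by
    simp only [hγ, AffineMap.lineMap_apply_module']
    module
  have hseg : segment ℝ x y = γ '' Set.Icc 0 1 := by
    rw [segment_symm, segment_eq_image_lineMap]
  obtain ⟨_, hqC, hq⟩ := hCxy
  obtain ⟨q, hq01, rfl⟩ := hseg ▸ hq
  obtain ⟨t, ⟨⟨ht0, ht1⟩, htC⟩, hlast⟩ :=
    (isCompact_Icc.inter_right ((hT.isClosed hC).preimage hγ_cont)).exists_isGreatest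
      ⟨q, hq01, hqC⟩
  have htx : γ t ≠ x := fun h => hxC (h ▸ htC)
  have ht1' : t < 1 := ht1.lt_of_ne (by rintro rfl; exact htx (AffineMap.lineMap_apply_one y x))
  obtain ⟨u, hu, htu, hu1⟩ := (((hγ_cont.tendsto t).eventually
    (hT.eventually_mem_of_mem (γ t))).filter_mono nhdsWithin_le_nhds |>.and
      (Ioo_mem_nhdsGT ht1')).exists
  have hu01 : u ∈ Set.Icc (0 : ℝ) 1 := ⟨ht0.trans htu.le, hu1.le⟩
  have huC : γ u ∉ C := fun h => htu.not_ge (hlast ⟨hu01, h⟩)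
  obtain ⟨D, hD, huD⟩ := hT.exists_mem (γ u)
  have htD : γ t ∈ D := hu D hD huD
  have hCD : Adjacent T C D := (hT.eq_or_adjacent_of_mem_codimLE hC hD
    (hxy _ (hseg ▸ ⟨t, ⟨ht0, ht1⟩, rfl⟩) htx) htC htD).resolve_left (by rintro rfl; exact huC huD)
  have hut : 0 < u - t := sub_pos.2 htu
  refine ⟨D, hCD, γ t, ⟨htC, htD⟩, γ u, ⟨huD, huC⟩, hseg ▸ ⟨u, hu01, rfl⟩, (1 - t) / (u - t),
    div_pos (sub_pos.2 ht1') hut, ?_⟩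
  have hx : γ 1 = x := AffineMap.lineMap_apply_one y x
  rw [hγ_sub u t, smul_smul, div_mul_cancel₀ _ hut.ne', ← hγ_sub 1 t, hx]

lemma exists_affineEval_lt (hT : IsNormalTiling T) (hs : IsCanonicalScaling T s)
    (hΦ : IsPotentialOn T s Set.univ Φ) (hxy : ∀ w ∈ segment ℝ x y, w ≠ x → w ∈ codimLE T 1)
    (hC : C ∈ T) (hCxy : (C ∩ segment ℝ x y).Nonempty) (hxC : x ∉ C) :
    ∃ D ∈ T, (D ∩ segment ℝ x y).Nonempty ∧ affineEval (Φ C) x < affineEval (Φ D) x := by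
  obtain ⟨D, hCD, w, hw, z, ⟨hzD, hzC⟩, hzxy, r, hr, hxw⟩ :=
    hT.exists_adjacent_of_notMem hxy hC hCxy hxC
  obtain ⟨n, hn⟩ := hT.exists_isUnitNormal hCD
  have hle : ⟪n, w⟫_ℝ ≤ ⟪n, z⟫_ℝ := hn.2.2 w hw.1 z hzD
  have hne : ⟪n, w⟫_ℝ ≠ ⟪n, z⟫_ℝ := fun heq =>
    hzC (hT.mem_of_inner_eq hCD.symm hn.neg hw.symm hzD (by simp only [inner_neg_left, heq]))
  have hpos : 0 < ⟪n, x - w⟫_ℝ := by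
    rw [hxw, inner_smul_right, inner_sub_right]
    exact mul_pos hr (sub_pos.2 (hle.lt_of_ne hne))
  refine ⟨D, hCD.2.1, ⟨z, hzD, hzxy⟩, sub_pos.1 ?_⟩
  rw [hT.affineEval_sub_affineEval hΦ hCD hn hw]
  exact mul_pos (hs.pos _ hCD.2.2.2) hpos

lemma affineEval_lt (hT : IsNormalTiling T) (hs : IsCanonicalScaling T s)
    (hΦ : IsPotentialOn T s Set.univ Φ) (hA : A ∈ T) (hB : B ∈ T) (hxA : x ∈ A) (hxB : x ∉ B) :
    affineEval (Φ B) x < affineEval (Φ A) x := by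
  obtain ⟨y, hy, hxy⟩ := hT.exists_mem_forall_segment_mem_codimLE (j := 0)
    (Set.countable_singleton {x}) (by simp [dim]) isOpen_interior (hT.interior_nonempty hB)
  replace hxy := hxy {x} rfl x rfl
  have hfinite : {C : T | (C.1 ∩ segment ℝ x y).Nonempty}.Finite :=
    hT.locallyFinite.finite_nonempty_inter_compact
      (convexHull_pair (𝕜 := ℝ) x y ▸ (Set.toFinite _).isCompact_convexHull ℝ)
  have hBxy : (B ∩ segment ℝ x y).Nonempty := ⟨y, interior_subset hy, right_mem_segment ℝ x y⟩
  obtain ⟨C, hCxy, hmax⟩ := Set.exists_max_image _ (fun C => affineEval (Φ C.1) x) hfinite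
    ⟨⟨B, hB⟩, hBxy⟩
  have hxC : x ∈ C.1 := by
    by_contra hxC
    obtain ⟨D, hD, hDxy, hlt⟩ := hT.exists_affineEval_lt hs hΦ hxy C.2 hCxy hxC
    exact (hmax ⟨D, hD⟩ hDxy).not_gt hlt
  obtain ⟨D, hD, hDxy, hlt⟩ := hT.exists_affineEval_lt hs hΦ hxy hB hBxy hxB
  rw [← hT.affineEval_eq_of_mem hΦ hA C.2 hxA hxC]
  exact hlt.trans_le (hmax ⟨D, hD⟩ hDxy)

lemma affineEval_le (hT : IsNormalTiling T) (hs : IsCanonicalScaling T s)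
    (hΦ : IsPotentialOn T s Set.univ Φ) (hA : A ∈ T) (hB : B ∈ T) (hxA : x ∈ A) :
    affineEval (Φ B) x ≤ affineEval (Φ A) x := by
  by_cases hxB : x ∈ B
  · exact (hT.affineEval_eq_of_mem hΦ hA hB hxA hxB).le
  · exact (hT.affineEval_lt hs hΦ hA hB hxA hxB).le

end IsNormalTiling

end Convexity

/-! ### Bounded sets and discrete subgroups -/

section RelativelyDense

variable {V : Type*} [NormedAddCommGroup V] [NormedSpace ℝ V] {A S : Set V}

lemma eq_zero_of_forall_add_mem (hA : Bornology.IsBounded A) (hne : A.Nonempty) {v : V}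
    (h : ∀ x ∈ A, v + x ∈ A) : v = 0 := by
  obtain ⟨a, ha⟩ := hne
  obtain ⟨M, hM⟩ := hA.exists_norm_le
  have hmem : ∀ N : ℕ, N • v + a ∈ A := fun N => by
    induction N with
    | zero => simpa using ha
    | succ N ih => simpa only [succ_nsmul', add_assoc] using h _ ih
  by_contra hv
  obtain ⟨N, hN⟩ := exists_nat_gt ((M + ‖a‖) / ‖v‖)
  rw [div_lt_iff₀ (norm_pos_iff.2 hv), ← nsmul_eq_mul, ← RCLike.norm_nsmul ℝ] at hN
  have hle : ‖N • v‖ ≤ ‖N • v + a‖ + ‖a‖ := norm_le_add_norm_add _ _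
  linarith [hM _ (hmem N)]

lemma eq_of_vadd_eq_vadd (hA : Bornology.IsBounded A) (hne : A.Nonempty) {v w : V}
    (h : v +ᵥ A = w +ᵥ A) : v = w := by
  refine sub_eq_zero.1 (eq_zero_of_forall_add_mem hA hne fun x hx => ?_)
  have hmem : v +ᵥ x ∈ w +ᵥ A := h ▸ Set.vadd_mem_vadd_set hx
  rwa [Set.mem_vadd_set_iff_neg_vadd_mem, vadd_vadd, vadd_eq_add, neg_add_eq_sub] at hmem

lemma exists_tendsto_inv_smul (hA : Bornology.IsBounded A)
    (h : ∀ x : V, ∃ v ∈ S, ∃ y ∈ A, x = v + y) (x : V) :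
    ∃ v : ℕ → V, (∀ N, v N ∈ S) ∧
      Filter.Tendsto (fun N : ℕ => (N : ℝ)⁻¹ • v N) Filter.atTop (nhds x) := by
  choose v hv y hy hxy using fun N : ℕ => h ((N : ℝ) • x)
  obtain ⟨M, hM⟩ := hA.exists_norm_le
  have hlim := NormedField.tendsto_zero_smul_of_tendsto_zero_of_bounded
    (tendsto_inv_atTop_nhds_zero_nat (𝕜 := ℝ))
    (Filter.isBoundedUnder_of ⟨M, fun N => hM _ (hy N)⟩)
  refine ⟨v, hv, (sub_zero x ▸ hlim.const_sub x :).congr' ?_⟩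
  filter_upwards [Filter.eventually_ne_atTop 0] with N hN
  rw [Pi.smul_apply', sub_eq_iff_eq_add, ← smul_add, ← hxy,
    inv_smul_smul₀ (Nat.cast_ne_zero.2 hN)]

lemma span_eq_top_of_forall_exists_eq_add [FiniteDimensional ℝ V] (hA : Bornology.IsBounded A)
    (h : ∀ x : V, ∃ v ∈ S, ∃ y ∈ A, x = v + y) : Submodule.span ℝ S = ⊤ := by
  refine Submodule.eq_top_iff'.2 fun x => ?_
  obtain ⟨v, hv, hlim⟩ := exists_tendsto_inv_smul hA h x
  exact (Submodule.closed_of_finiteDimensional _).mem_of_tendsto hlim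
    (Filter.Eventually.of_forall fun N => Submodule.smul_mem _ _ (Submodule.subset_span (hv N)))

lemma exists_linearMap_eqOn [FiniteDimensional ℝ V] {W : Type*} [AddCommGroup W] [Module ℝ W]
    (Λ : AddSubgroup V) [DiscreteTopology Λ] (hΛ : Submodule.span ℝ (Λ : Set V) = ⊤) {f : V → W}
    (hf : ∀ v ∈ Λ, ∀ w ∈ Λ, f (v + w) = f v + f w) : ∃ L : V →ₗ[ℝ] W, Set.EqOn f L Λ := by
  let Λ' : Submodule ℤ V := AddSubgroup.toIntSubmodule Λ
  have : DiscreteTopology Λ' := ‹DiscreteTopology Λ›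
  have : IsZLattice ℝ Λ' := ⟨hΛ⟩
  have : Module.Free ℤ Λ' := ZLattice.module_free ℝ Λ'
  let b := Module.Free.chooseBasis ℤ Λ'
  let L : V →ₗ[ℝ] W := (b.ofZLatticeBasis ℝ Λ').constr ℝ fun i => f (b i)
  let φ : Λ' →+ W := AddMonoidHom.mk' (fun v => f v) fun v w => hf v v.2 w w.2
  have hL : φ.toIntLinearMap = (L.restrictScalars ℤ).comp Λ'.subtype := b.ext fun i => by
    have hbi := (b.ofZLatticeBasis ℝ Λ').constr_basis ℝ (fun i => f (b i)) i
    rw [Module.Basis.ofZLatticeBasis_apply] at hbi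
    exact hbi.symm
  exact ⟨L, fun v hv => LinearMap.congr_fun hL ⟨v, hv⟩⟩

end RelativelyDense

/-! ### The lattice of translations -/

section Translations

variable {d : ℕ} {P : Set (E d)} {T : Set (Set (E d))} {A B C : Set (E d)} {s : Set (E d) → ℝ}

lemma dim_vadd (v : E d) (F : Set (E d)) : dim (v +ᵥ F) = dim F := by
  rw [dim, vectorSpan_vadd, dim]

lemma maxFace_vadd (n v : E d) (A : Set (E d)) : maxFace n (v +ᵥ A) = v +ᵥ maxFace n A := by
  ext x
  simp only [maxFace, Set.mem_vadd_set_iff_neg_vadd_mem, Set.mem_ofPred_eq, vadd_eq_add,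
    inner_add_right, inner_neg_right]
  refine and_congr_right fun _ => ⟨fun h y hy => ?_, fun h y hy => ?_⟩
  · have := h (v + y) (by rwa [neg_add_cancel_left])
    rw [inner_add_right] at this
    linarith
  · have := h (-v + y) hy
    rw [inner_add_right, inner_neg_right] at this
    linarith

lemma IsUnitNormal.vadd {n : E d} (h : IsUnitNormal A B n) (v : E d) :
    IsUnitNormal (v +ᵥ A) (v +ᵥ B) n := by
  refine ⟨h.1, ?_, ?_⟩
  · rw [← Set.vadd_set_inter, vectorSpan_vadd]
    exact h.2.1
  · rintro _ ⟨a, ha, rfl⟩ _ ⟨b, hb, rfl⟩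
    simp only [vadd_eq_add, inner_add_right, add_le_add_iff_left]
    exact h.2.2 a ha b hb

/-- The group of translations that preserve the tiling. -/
def translationGroup (T : Set (Set (E d))) : AddSubgroup (E d) := AddAction.stabilizer (E d) T

lemma vadd_mem_iff {v : E d} (hv : v ∈ translationGroup T) : v +ᵥ A ∈ T ↔ A ∈ T :=
  AddAction.mem_stabilizer_set.1 hv A

namespace IsNormalTiling

lemma adjacent_vadd (hT : IsNormalTiling T) {v : E d} (hv : v ∈ translationGroup T)
    (h : Adjacent T A B) : Adjacent T (v +ᵥ A) (v +ᵥ B) := by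
  refine hT.adjacent_of_le_dim ((vadd_mem_iff hv).2 h.1) ((vadd_mem_iff hv).2 h.2.1)
    ((AddAction.injective v).ne h.2.2.1) ?_ ?_
  · rw [← Set.vadd_set_inter]
    exact h.nonempty.vadd_set
  · rw [← Set.vadd_set_inter, dim_vadd]
    exact h.dim_eq.ge

lemma affineEval_jump_vadd (hT : IsNormalTiling T) (hinv : IsTranslationInvariant T s) {v : E d}
    (hv : v ∈ translationGroup T) (h : Adjacent T A B) (x : E d) :
    affineEval (jump s (v +ᵥ A) (v +ᵥ B)) (v + x) = affineEval (jump s A B) x := by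
  obtain ⟨n, hn⟩ := hT.exists_isUnitNormal h
  obtain ⟨w, hw⟩ := h.nonempty
  have hvw : v + w ∈ (v +ᵥ A) ∩ (v +ᵥ B) :=
    ⟨Set.vadd_mem_vadd_set hw.1, Set.vadd_mem_vadd_set hw.2⟩
  rw [hT.affineEval_jump h hn hw, hT.affineEval_jump (hT.adjacent_vadd hv h) (hn.vadd v) hvw,
    ← Set.vadd_set_inter, hinv v hv _ h.2.2.2, add_sub_add_left_eq_sub]

end IsNormalTiling

namespace IsParallelohedralTiling

lemma isCompact (hT : IsParallelohedralTiling P T) (hA : A ∈ T) : IsCompact A := by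
  obtain ⟨⟨V, hV, rfl⟩, -⟩ := hT.polytope
  obtain ⟨v, rfl⟩ := hT.translates A hA
  exact (hV.isCompact_convexHull ℝ).vadd v

lemma interior_nonempty (hT : IsParallelohedralTiling P T) (hA : A ∈ T) :
    (interior A).Nonempty := by
  obtain ⟨v, rfl⟩ := hT.translates A hA
  rw [interior_vadd]
  exact hT.polytope.2.vadd_set

/-- A ball of a suitable radius contains all tiles meeting a given unit ball. These have disjoint
interiors of the same positive volume. -/
lemma locallyFinite (hT : IsParallelohedralTiling P T) :
    LocallyFinite fun A : T => (A : Set (E d)) := by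
  intro x
  have hP := hT.polytope.2
  let K := Metric.closedBall x (1 + Metric.diam P)
  have hdisj : Pairwise fun A B : T => Disjoint (interior A.1 ∩ K) (interior B.1 ∩ K) :=
    fun A B hAB => Set.disjoint_left.2 fun y hyA hyB => hAB <| Subtype.ext <|
      eq_of_isExposed_inter_of_mem_interior (hT.face_to_face A A.2 B B.2).1
        (hT.face_to_face A A.2 B B.2).2 (interior_subset hyA.1) hyB.1
  refine ⟨Metric.closedBall x 1, Metric.closedBall_mem_nhds x one_pos,
    (MeasureTheory.Measure.finite_const_le_meas_of_disjoint_iUnion MeasureTheory.volume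
      (isOpen_interior.measure_pos MeasureTheory.volume hP)
      (fun A => isOpen_interior.measurableSet.inter Metric.isClosed_closedBall.measurableSet) hdisj
      ?_).subset fun A hA => ?_⟩
  · exact ((MeasureTheory.measure_mono (Set.iUnion_subset fun _ => Set.inter_subset_right)).trans_lt
      (isCompact_closedBall x _).measure_lt_top).ne
  · obtain ⟨y, hyA, hyx⟩ := hA
    obtain ⟨v, hv⟩ := hT.translates A A.2
    have hAK : A.1 ⊆ K := fun z hz => by
      have hzy := Metric.dist_le_diam_of_mem ((hT.isCompact A.2).isBounded) hz hyA
      have hdiam : Metric.diam A.1 = Metric.diam P := by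
        rw [hv, diam_vadd]
      rw [Metric.mem_closedBall] at hyx ⊢
      linarith [dist_triangle z y x]
    rw [Set.mem_ofPred_eq, Set.inter_eq_left.2 (interior_subset.trans hAK), hv, interior_vadd,
      MeasureTheory.measure_vadd]

lemma isNormalTiling (hT : IsParallelohedralTiling P T) : IsNormalTiling T where
  isClosed _ hA := (hT.isCompact hA).isClosed
  convex A hA := by
    obtain ⟨⟨V, -, rfl⟩, -⟩ := hT.polytope
    obtain ⟨v, rfl⟩ := hT.translates A hA
    exact (convex_convexHull ℝ V).vadd v
  interior_nonempty _ := hT.interior_nonempty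
  sUnion_eq := hT.covers
  isExposed_inter A hA B hB := (hT.face_to_face A hA B hB).1
  locallyFinite := hT.locallyFinite

lemma exists_eq_vadd (hT : IsParallelohedralTiling P T) (hA : A ∈ T) (hB : B ∈ T) :
    ∃ v : E d, B = v +ᵥ A := by
  obtain ⟨a, rfl⟩ := hT.translates A hA
  obtain ⟨b, rfl⟩ := hT.translates B hB
  exact ⟨b - a, by rw [vadd_vadd, sub_add_cancel]⟩

/-- Let `n` be the normal from `A` to `t +ᵥ A`. Across the facet of `C` with outer normal `n` lies
some tile `t' +ᵥ C`; the facets with outer normals `n` and `-n` differ by `t`, and also by `t'`. -/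
lemma vadd_mem_of_adjacent (hT : IsParallelohedralTiling P T) {t : E d}
    (h : Adjacent T A (t +ᵥ A)) (hC : C ∈ T) : t +ᵥ C ∈ T := by
  have hN := hT.isNormalTiling
  obtain ⟨n, hn⟩ := hN.exists_isUnitNormal h
  have hA := hN.inter_eq_maxFace h hn
  have hA' : maxFace n A = t +ᵥ maxFace (-n) A := by
    rw [← hA, Set.inter_comm, hN.inter_eq_maxFace h.symm hn.neg, maxFace_vadd]
  obtain ⟨v, rfl⟩ := hT.exists_eq_vadd h.1 hC
  obtain ⟨B, hCB, hB⟩ := hN.exists_adjacent_inter_eq hC (isExposed_maxFace n (v +ᵥ A))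
    (by rw [maxFace_vadd, ← hA]; exact h.nonempty.vadd_set)
    (by rw [maxFace_vadd, dim_vadd, ← hA, h.dim_eq])
  have hnB := hN.isUnitNormal_of_inter_eq_maxFace hCB hn.1 hB
  obtain ⟨t', rfl⟩ := hT.exists_eq_vadd hC hCB.2.1
  have hC' : maxFace n (v +ᵥ A) = t' +ᵥ maxFace (-n) (v +ᵥ A) := by
    rw [← hB, Set.inter_comm, hN.inter_eq_maxFace hCB.symm hnB.neg, maxFace_vadd]
  have hne : (maxFace (-n) (v +ᵥ A)).Nonempty :=
    Set.vadd_set_nonempty.1 (hC' ▸ hB ▸ hCB.nonempty)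
  have htt' : t = t' := by
    refine eq_of_vadd_eq_vadd ((hT.isCompact hC).isBounded.subset (maxFace_subset _ _)) hne ?_
    rw [← hC', maxFace_vadd, maxFace_vadd, hA', vadd_comm]
  exact htt' ▸ hCB.2.1

lemma mem_translationGroup_of_adjacent (hT : IsParallelohedralTiling P T) {t : E d}
    (h : Adjacent T A (t +ᵥ A)) : t ∈ translationGroup T := by
  refine AddAction.mem_stabilizer_set.2 fun C => ⟨fun hC => ?_, hT.vadd_mem_of_adjacent h⟩
  rw [← neg_vadd_vadd t C]
  exact hT.vadd_mem_of_adjacent (A := t +ᵥ A) (by rw [neg_vadd_vadd]; exact h.symm) hC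

lemma exists_mem_translationGroup_eq_vadd (hT : IsParallelohedralTiling P T) (hA : A ∈ T)
    (hB : B ∈ T) : ∃ v ∈ translationGroup T, B = v +ᵥ A := by
  refine hT.isNormalTiling.forall_of_adjacent_univ
    (fun C => ∃ v ∈ translationGroup T, C = v +ᵥ A) ?_ hA ⟨0, zero_mem _, by simp⟩ hB
  rintro C D hCD ⟨v, hv, rfl⟩
  obtain ⟨t, rfl⟩ := hT.exists_eq_vadd hCD.1 hCD.2.1
  exact ⟨t + v, add_mem (hT.mem_translationGroup_of_adjacent hCD) hv, by rw [vadd_vadd]⟩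

lemma discreteTopology_translationGroup (hT : IsParallelohedralTiling P T) (hA : A ∈ T) :
    DiscreteTopology (translationGroup T) := by
  obtain ⟨p, hp⟩ := hT.interior_nonempty hA
  suffices {v : translationGroup T | (v : E d) + p ∈ interior A} = {0} from
    discreteTopology_of_isOpen_singleton_zero
      (this ▸ isOpen_interior.preimage (by fun_prop))
  refine Set.eq_singleton_iff_unique_mem.2 ⟨by simpa using hp, fun v hv => Subtype.ext ?_⟩
  have hvA : (v : E d) +ᵥ A = A := hT.isNormalTiling.eq_of_mem_interior ((vadd_mem_iff v.2).2 hA) hA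
    (Set.vadd_mem_vadd_set (interior_subset hp)) hv
  exact eq_of_vadd_eq_vadd (hT.isCompact hA).isBounded ⟨p, interior_subset hp⟩
    (hvA.trans (zero_vadd (E d) A).symm)

lemma exists_eq_add (hT : IsParallelohedralTiling P T) (hA : A ∈ T) (x : E d) :
    ∃ v ∈ translationGroup T, ∃ y ∈ A, x = v + y := by
  obtain ⟨B, hB, hx⟩ := hT.isNormalTiling.exists_mem x
  obtain ⟨v, hv, rfl⟩ := hT.exists_mem_translationGroup_eq_vadd hA hB
  obtain ⟨y, hy, rfl⟩ := hx
  exact ⟨v, hv, y, hy, rfl⟩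

end IsParallelohedralTiling

end Translations

/-! ### The quadratic form -/

section LinearMaps

variable {V : Type*} [NormedAddCommGroup V] [InnerProductSpace ℝ V] {L : V →ₗ[ℝ] V} {A S : Set V}

lemma isSymmetric_of_span_eq_top (hS : Submodule.span ℝ S = ⊤)
    (h : ∀ v ∈ S, ∀ w ∈ S, ⟪L v, w⟫_ℝ = ⟪v, L w⟫_ℝ) : L.IsSymmetric := fun x y => by
  have heq : (innerₗ V).comp L = (innerₗ V).compl₂ L :=
    LinearMap.ext_on hS fun v hv => LinearMap.ext_on hS fun w hw => h v hv w hw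
  exact LinearMap.congr_fun₂ heq x y

lemma inner_self_nonneg_of_forall_mem [FiniteDimensional ℝ V] (hA : Bornology.IsBounded A)
    (hS : ∀ x : V, ∃ v ∈ S, ∃ y ∈ A, x = v + y) (h : ∀ v ∈ S, 0 ≤ ⟪L v, v⟫_ℝ) (x : V) :
    0 ≤ ⟪L x, x⟫_ℝ := by
  obtain ⟨v, hv, hlim⟩ := exists_tendsto_inv_smul hA hS x
  have hL : Continuous L := L.continuous_of_finiteDimensional
  refine ge_of_tendsto' (((hL.tendsto x).comp hlim).inner hlim) fun N => ?_
  simp only [Function.comp_apply, map_smul, real_inner_smul_left, real_inner_smul_right]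
  exact mul_nonneg (by positivity) (mul_nonneg (by positivity) (h _ (hv N)))

end LinearMaps

section QuadraticForms

variable {d : ℕ} {Q : Matrix (Fin d) (Fin d) ℝ}

lemma posDef_of_isPositive (hQ : (Matrix.toEuclideanLin Q).IsPositive)
    (h : ∀ x, Matrix.toEuclideanLin Q x = 0 → x = 0) : Q.PosDef := by
  refine (Matrix.isPositive_toEuclideanLin_iff.1 hQ).posDef_iff_isUnit.2
    (Matrix.mulVec_injective_iff_isUnit.1 ?_)
  refine (injective_iff_map_eq_zero Q.mulVecLin).2 fun x hx => ?_
  have := h (WithLp.toLp 2 x) (congrArg (WithLp.toLp 2) hx)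
  exact congrArg WithLp.ofLp this

lemma quadForm_zero (Q : Matrix (Fin d) (Fin d) ℝ) : quadForm Q 0 = 0 := by simp [quadForm]

lemma quadForm_neg (Q : Matrix (Fin d) (Fin d) ℝ) (x : E d) : quadForm Q (-x) = quadForm Q x := by
  simp only [quadForm, map_neg, inner_neg_neg]

lemma quadForm_pos (hQ : Q.PosDef) {x : E d} (hx : x ≠ 0) : 0 < quadForm Q x := by
  have h := hQ.dotProduct_mulVec_pos (x := x.ofLp) fun h => hx (congrArg (WithLp.toLp 2) h)
  rw [quadForm, EuclideanSpace.inner_eq_star_dotProduct, dotProduct_comm]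
  exact mul_pos one_half_pos h

lemma quadForm_nonneg (hQ : Q.PosDef) (x : E d) : 0 ≤ quadForm Q x := by
  obtain rfl | hx := eq_or_ne x 0
  exacts [(quadForm_zero Q).ge, (quadForm_pos hQ hx).le]

lemma quadForm_sub_quadForm_sub (hQ : Q.IsHermitian) (x v : E d) :
    quadForm Q x - quadForm Q (x - v) = ⟪Matrix.toEuclideanLin Q v, x⟫_ℝ - quadForm Q v := by
  have hxv : ⟪x, Matrix.toEuclideanLin Q v⟫_ℝ = ⟪Matrix.toEuclideanLin Q v, x⟫_ℝ :=
    real_inner_comm _ _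
  have hvx : ⟪v, Matrix.toEuclideanLin Q x⟫_ℝ = ⟪Matrix.toEuclideanLin Q v, x⟫_ℝ :=
    (Matrix.isSymmetric_toEuclideanLin_iff.2 hQ v x).symm
  simp only [quadForm, map_sub, inner_sub_left, inner_sub_right, hxv, hvx]
  ring

lemma hasGradientAt_quadForm (hQ : Q.IsHermitian) (c x : E d) :
    HasGradientAt (fun y => quadForm Q (y - c)) (Matrix.toEuclideanLin Q (x - c)) x := by
  let L : E d →L[ℝ] E d := (Matrix.toEuclideanLin Q).toContinuousLinearMap
  have hsub : HasFDerivAt (fun y : E d => y - c) (ContinuousLinearMap.id ℝ (E d)) x :=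
    (hasFDerivAt_id x).sub_const c
  have hL : HasFDerivAt (fun y : E d => L (y - c)) L x := L.hasFDerivAt.comp x hsub
  refine hasGradientAt_iff_hasFDerivAt.2 (((hsub.inner ℝ hL).const_mul (1 / 2)).congr_fderiv ?_)
  ext y
  have hsymm : ⟪x - c, L y⟫_ℝ = ⟪L (x - c), y⟫_ℝ :=
    (Matrix.isSymmetric_toEuclideanLin_iff.2 hQ (x - c) y).symm
  have hcomm : ⟪y, L (x - c)⟫_ℝ = ⟪L (x - c), y⟫_ℝ := real_inner_comm _ _
  change 1 / 2 * (⟪x - c, L y⟫_ℝ + ⟪y, L (x - c)⟫_ℝ) = ⟪L (x - c), y⟫_ℝ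
  rw [hsymm, hcomm]
  ring

end QuadraticForms

section AffineCocycles

variable {d : ℕ} {Λ : AddSubgroup (E d)} {φ : E d → E d × ℝ} {v w : E d}

/-- The relation satisfied by the affine functions `φ v` over the tiles `v +ᵥ P₀` of a periodic
lifting that vanishes over `P₀`: translating the lifting by `v` changes it by the affine function
`φ v`. -/
def IsAffineCocycle (Λ : AddSubgroup (E d)) (φ : E d → E d × ℝ) : Prop :=
  ∀ v ∈ Λ, ∀ w ∈ Λ, ∀ x,
    affineEval (φ (v + w)) (v + x) = affineEval (φ w) x + affineEval (φ v) (v + x)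

namespace IsAffineCocycle

lemma fst_add (hφ : IsAffineCocycle Λ φ) (hv : v ∈ Λ) (hw : w ∈ Λ) :
    (φ (v + w)).1 = (φ v).1 + (φ w).1 := by
  refine ext_inner_right ℝ fun x => ?_
  have hx := hφ v hv w hw x
  have h0 := hφ v hv w hw 0
  simp only [affineEval, inner_add_right, inner_zero_right, inner_add_left] at hx h0 ⊢
  linarith

lemma snd_add (hφ : IsAffineCocycle Λ φ) (hv : v ∈ Λ) (hw : w ∈ Λ) :
    (φ (v + w)).2 = (φ v).2 + (φ w).2 - ⟪(φ w).1, v⟫_ℝ := by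
  have h0 := hφ v hv w hw 0
  simp only [affineEval, hφ.fst_add hv hw, inner_add_right, inner_zero_right,
    inner_add_left] at h0
  linarith

lemma inner_fst_comm (hφ : IsAffineCocycle Λ φ) (hv : v ∈ Λ) (hw : w ∈ Λ) :
    ⟪(φ v).1, w⟫_ℝ = ⟪(φ w).1, v⟫_ℝ := by
  have hvw := hφ.snd_add hv hw
  have hwv := hφ.snd_add hw hv
  rw [add_comm w v] at hwv
  linarith

/-- The gradients are additive; the constants become additive after adding the quadratic term. -/
theorem exists_isSymmetric (hφ : IsAffineCocycle Λ φ) [DiscreteTopology Λ]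
    (hΛ : Submodule.span ℝ (Λ : Set (E d)) = ⊤) :
    ∃ (L : E d →ₗ[ℝ] E d) (m : E d), L.IsSymmetric ∧
      ∀ v ∈ Λ, φ v = (L v, ⟪m, v⟫_ℝ - 1 / 2 * ⟪v, L v⟫_ℝ) := by
  obtain ⟨L, hL⟩ := exists_linearMap_eqOn Λ hΛ (f := fun v => (φ v).1)
    fun v hv w hw => hφ.fst_add hv hw
  replace hL : ∀ v ∈ Λ, (φ v).1 = L v := hL
  have hsymm : L.IsSymmetric := isSymmetric_of_span_eq_top hΛ fun v hv w hw => by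
    rw [← hL v hv, ← hL w hw, hφ.inner_fst_comm hv hw, real_inner_comm]
  obtain ⟨l, hl⟩ := exists_linearMap_eqOn Λ hΛ (f := fun v => (φ v).2 + 1 / 2 * ⟪v, L v⟫_ℝ)
    fun v hv w hw => by
      have hvw : ⟪L w, v⟫_ℝ = ⟪w, L v⟫_ℝ := hsymm w v
      have hcomm : ⟪v, L w⟫_ℝ = ⟪L w, v⟫_ℝ := real_inner_comm _ _
      rw [hφ.snd_add hv hw, hL w hw]
      simp only [map_add, inner_add_left, inner_add_right, hcomm, hvw]
      ring
  refine ⟨L, (InnerProductSpace.toDual ℝ (E d)).symm l.toContinuousLinearMap, hsymm,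
    fun v hv => Prod.ext (hL v hv) ?_⟩
  rw [InnerProductSpace.toDual_symm_apply, eq_sub_iff_add_eq]
  exact hl hv

end IsAffineCocycle

end AffineCocycles

/-! ### The paraboloid -/

section Paraboloid

variable {d : ℕ} {P P₀ : Set (E d)} {T : Set (Set (E d))} {A : Set (E d)} {s : Set (E d) → ℝ}
  {Φ : Set (E d) → E d × ℝ} {Q : Matrix (Fin d) (Fin d) ℝ} {c v x : E d}

lemma IsNormalTiling.affineEval_vadd (hT : IsNormalTiling T) (hinv : IsTranslationInvariant T s)
    (hΦ : IsPotentialOn T s Set.univ Φ) (hP₀ : P₀ ∈ T) (hΦ₀ : Φ P₀ = 0)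
    (hv : v ∈ translationGroup T) (hA : A ∈ T) (x : E d) :
    affineEval (Φ (v +ᵥ A)) (v + x) = affineEval (Φ A) x + affineEval (Φ (v +ᵥ P₀)) (v + x) := by
  refine hT.forall_of_adjacent_univ (fun B => affineEval (Φ (v +ᵥ B)) (v + x) =
    affineEval (Φ B) x + affineEval (Φ (v +ᵥ P₀)) (v + x)) (fun B C hBC hB => ?_) hP₀ ?_ hA
  · have hstep : affineEval (Φ (v +ᵥ C)) (v + x) - affineEval (Φ (v +ᵥ B)) (v + x) =
        affineEval (Φ C) x - affineEval (Φ B) x := by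
      rw [← affineEval_sub, ← affineEval_sub, hΦ.sub_eq_jump hBC,
        hΦ.sub_eq_jump (hT.adjacent_vadd hv hBC), hT.affineEval_jump_vadd hinv hv hBC]
    linarith
  · simp [hΦ₀, affineEval]

lemma IsNormalTiling.isAffineCocycle (hT : IsNormalTiling T) (hinv : IsTranslationInvariant T s)
    (hΦ : IsPotentialOn T s Set.univ Φ) (hP₀ : P₀ ∈ T) (hΦ₀ : Φ P₀ = 0) :
    IsAffineCocycle (translationGroup T) fun v => Φ (v +ᵥ P₀) := fun v hv w hw x => by
  simpa only [add_vadd] using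
    hT.affineEval_vadd hinv hΦ hP₀ hΦ₀ hv ((vadd_mem_iff hw).2 hP₀) x

/-- Every translate of `P₀` is lifted by the affine function whose graph is tangent, above the point
`v + c` corresponding to `c`, to the paraboloid of `Q` with vertex at `c`. -/
structure IsTangentParaboloid (T : Set (Set (E d))) (Φ : Set (E d) → E d × ℝ) (P₀ : Set (E d))
    (Q : Matrix (Fin d) (Fin d) ℝ) (c : E d) : Prop where
  posDef : Q.PosDef
  fst_eq : ∀ v ∈ translationGroup T, (Φ (v +ᵥ P₀)).1 = Matrix.toEuclideanLin Q v
  affineEval_eq : ∀ v ∈ translationGroup T, ∀ x,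
    affineEval (Φ (v +ᵥ P₀)) x = quadForm Q (x - c) - quadForm Q (x - (v + c))

namespace IsParallelohedralTiling

lemma mem_iff_affineEval_nonpos (hT : IsParallelohedralTiling P T) (hs : IsCanonicalScaling T s)
    (hΦ : IsPotentialOn T s Set.univ Φ) (hP₀ : P₀ ∈ T) (hΦ₀ : Φ P₀ = 0) :
    x ∈ P₀ ↔ ∀ v ∈ translationGroup T, affineEval (Φ (v +ᵥ P₀)) x ≤ 0 := by
  have hT' := hT.isNormalTiling
  have hzero : affineEval (Φ P₀) x = 0 := by simp [hΦ₀, affineEval]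
  refine ⟨fun hx v hv => hzero ▸ hT'.affineEval_le hs hΦ hP₀ ((vadd_mem_iff hv).2 hP₀) hx,
    fun h => ?_⟩
  by_contra hx
  obtain ⟨A, hA, hxA⟩ := hT'.exists_mem x
  obtain ⟨v, hv, rfl⟩ := hT.exists_mem_translationGroup_eq_vadd hP₀ hA
  exact (hzero ▸ hT'.affineEval_lt hs hΦ hA hP₀ hxA hx).not_ge (h v hv)

/-- The lifting is at least `0` over `v +ᵥ P₀`, and the affine function over this tile is at most
`0` on `P₀`; it therefore does not decrease from `x` to `v + x`. -/
lemma inner_fst_self_nonneg (hT : IsParallelohedralTiling P T) (hs : IsCanonicalScaling T s)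
    (hΦ : IsPotentialOn T s Set.univ Φ) (hP₀ : P₀ ∈ T) (hΦ₀ : Φ P₀ = 0)
    (hv : v ∈ translationGroup T) : 0 ≤ ⟪(Φ (v +ᵥ P₀)).1, v⟫_ℝ := by
  have hT' := hT.isNormalTiling
  obtain ⟨x, hx⟩ := hT'.nonempty hP₀
  have hP₀_le := (hT.mem_iff_affineEval_nonpos hs hΦ hP₀ hΦ₀).1 hx v hv
  have hle := hT'.affineEval_le hs hΦ ((vadd_mem_iff hv).2 hP₀) hP₀ (Set.vadd_mem_vadd_set hx)
  simp only [hΦ₀, affineEval, vadd_eq_add, inner_add_right, Prod.fst_zero, inner_zero_left,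
    Prod.snd_zero] at hP₀_le hle
  linarith

/-- A vector orthogonal to all the gradients is a period of `P₀`. -/
lemma eq_zero_of_forall_inner_fst_eq_zero (hT : IsParallelohedralTiling P T)
    (hs : IsCanonicalScaling T s) (hΦ : IsPotentialOn T s Set.univ Φ) (hP₀ : P₀ ∈ T)
    (hΦ₀ : Φ P₀ = 0) (h : ∀ v ∈ translationGroup T, ⟪(Φ (v +ᵥ P₀)).1, x⟫_ℝ = 0) : x = 0 := by
  refine eq_zero_of_forall_add_mem (hT.isCompact hP₀).isBounded (hT.isNormalTiling.nonempty hP₀)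
    fun y hy => ?_
  rw [hT.mem_iff_affineEval_nonpos hs hΦ hP₀ hΦ₀] at hy ⊢
  intro v hv
  rw [affineEval, inner_add_right, h v hv, zero_add]
  exact hy v hv

theorem exists_isTangentParaboloid (hT : IsParallelohedralTiling P T)
    (hs : IsCanonicalScaling T s) (hinv : IsTranslationInvariant T s)
    (hΦ : IsPotentialOn T s Set.univ Φ) (hP₀ : P₀ ∈ T) (hΦ₀ : Φ P₀ = 0) :
    ∃ Q c, IsTangentParaboloid T Φ P₀ Q c := by
  have := hT.discreteTopology_translationGroup hP₀
  have hbdd := (hT.isCompact hP₀).isBounded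
  obtain ⟨L, m, hL, hΦL⟩ := (hT.isNormalTiling.isAffineCocycle hinv hΦ hP₀ hΦ₀).exists_isSymmetric
    (span_eq_top_of_forall_exists_eq_add hbdd (hT.exists_eq_add hP₀))
  obtain ⟨Q, rfl⟩ := Matrix.toEuclideanLin.surjective L
  set L := Matrix.toEuclideanLin Q
  have hfst : ∀ v ∈ translationGroup T, (Φ (v +ᵥ P₀)).1 = L v := fun v hv => by rw [hΦL v hv]
  have hnonneg : ∀ x, 0 ≤ ⟪L x, x⟫_ℝ :=
    inner_self_nonneg_of_forall_mem hbdd (hT.exists_eq_add hP₀) fun v hv =>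
      hfst v hv ▸ hT.inner_fst_self_nonneg hs hΦ hP₀ hΦ₀ hv
  have hker : ∀ x, L x = 0 → x = 0 := fun x hx =>
    hT.eq_zero_of_forall_inner_fst_eq_zero hs hΦ hP₀ hΦ₀ fun v hv => by
      rw [hfst v hv, hL v x, hx, inner_zero_right]
  have hQ : Q.PosDef := posDef_of_isPositive ⟨hL, hnonneg⟩ hker
  obtain ⟨c, hc⟩ := LinearMap.injective_iff_surjective.1 ((injective_iff_map_eq_zero L).2 hker) (-m)
  refine ⟨Q, c, hQ, hfst, fun v hv x => ?_⟩
  have hm : ⟪m, v⟫_ℝ = -⟪L v, c⟫_ℝ := by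
    rw [hL v c, hc, inner_neg_right, neg_neg, real_inner_comm]
  have hxvc : x - (v + c) = x - c - v := by abel
  rw [hΦL v hv, affineEval, hm, hxvc, quadForm_sub_quadForm_sub hQ.isHermitian, inner_sub_right,
    quadForm]
  ring

end IsParallelohedralTiling

end Paraboloid

/-! ### Centres of symmetry -/

section Centers

variable {d : ℕ} {P P₀ A : Set (E d)} {T : Set (Set (E d))} {s : Set (E d) → ℝ}
  {Φ : Set (E d) → E d × ℝ} {Q : Matrix (Fin d) (Fin d) ℝ} {a b c v x : E d}

namespace IsCenter

lemma unique (hA : Bornology.IsBounded A) (hne : A.Nonempty) (ha : IsCenter A a)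
    (hb : IsCenter A b) : a = b := by
  have htwo : (2 : ℝ) • (a - b) = 0 := eq_zero_of_forall_add_mem hA hne fun x hx => by
    convert ha _ (hb x hx) using 1
    module
  exact sub_eq_zero.1 ((smul_eq_zero.1 htwo).resolve_left two_ne_zero)

lemma vadd (ha : IsCenter A a) (v : E d) : IsCenter (v +ᵥ A) (v + a) := by
  rintro _ ⟨x, hx, rfl⟩
  refine ⟨_, ha x hx, ?_⟩
  simp only [vadd_eq_add]
  abel

lemma mem_interior (hA : Convex ℝ A) (hne : (interior A).Nonempty) (ha : IsCenter A a) :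
    a ∈ interior A := by
  obtain ⟨x, hx⟩ := hne
  convert hA.combo_interior_self_mem_interior hx (ha x (interior_subset hx))
    (a := 1 / 2) (b := 1 / 2) (by norm_num) (by norm_num) (by norm_num) using 1
  module

end IsCenter

namespace IsTangentParaboloid

/-- `P₀` is the Voronoi cell of `c` among the points `v + c`, for the norm of `Q`. -/
lemma mem_iff_forall_quadForm_le (hQ : IsTangentParaboloid T Φ P₀ Q c)
    (hT : IsParallelohedralTiling P T) (hs : IsCanonicalScaling T s)
    (hΦ : IsPotentialOn T s Set.univ Φ) (hP₀ : P₀ ∈ T) (hΦ₀ : Φ P₀ = 0) :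
    x ∈ P₀ ↔ ∀ v ∈ translationGroup T, quadForm Q (x - c) ≤ quadForm Q (x - (v + c)) := by
  rw [hT.mem_iff_affineEval_nonpos hs hΦ hP₀ hΦ₀]
  exact forall₂_congr fun v hv => by rw [hQ.affineEval_eq v hv, sub_nonpos]

lemma isCenter (hQ : IsTangentParaboloid T Φ P₀ Q c) (hT : IsParallelohedralTiling P T)
    (hs : IsCanonicalScaling T s) (hΦ : IsPotentialOn T s Set.univ Φ) (hP₀ : P₀ ∈ T)
    (hΦ₀ : Φ P₀ = 0) : IsCenter P₀ c := fun x hx => by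
  rw [hQ.mem_iff_forall_quadForm_le hT hs hΦ hP₀ hΦ₀] at hx ⊢
  intro v hv
  have hle := hx (-v) (neg_mem hv)
  rw [← quadForm_neg Q (x - c), ← quadForm_neg Q (x - (-v + c))] at hle
  convert hle using 2 <;> abel

end IsTangentParaboloid

lemma IsParallelohedralTiling.isCenter_vadd_iff (hT : IsParallelohedralTiling P T) (hA : A ∈ T)
    (hc : IsCenter A c) : IsCenter (v +ᵥ A) x ↔ x = v + c :=
  ⟨fun hx => hx.unique ((hT.isCompact hA).isBounded.vadd v)
    ((hT.isNormalTiling.nonempty hA).vadd_set) (hc.vadd v), fun h => h ▸ hc.vadd v⟩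

end Centers

/-! ### The generatrix -/

section Generatrix

variable {d : ℕ} {T : Set (Set (E d))} {P₀ A B : Set (E d)} {s : Set (E d) → ℝ}
  {Φ : Set (E d) → E d × ℝ} {φ ψ : E d × ℝ} {G : E d → ℝ} {L : Set (E d × ℝ)} {n v : E d}

/-- The lift of the tile `A` by the affine function `φ`: the part of the graph of `φ` over `A`. -/
def liftBy (φ : E d × ℝ) (A : Set (E d)) : Set (E d × ℝ) := {p | p.1 ∈ A ∧ p.2 = affineEval φ p.1}

lemma liftBy_zero (A : Set (E d)) : liftBy 0 A = A ×ˢ {0} := by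
  ext p
  simp [liftBy, affineEval]

lemma fst_image_liftBy (φ : E d × ℝ) (A : Set (E d)) : Prod.fst '' liftBy φ A = A :=
  Set.Subset.antisymm (Set.image_subset_iff.2 fun _ hp => hp.1)
    fun x hx => ⟨(x, affineEval φ x), ⟨hx, rfl⟩, rfl⟩

lemma fst_image_liftBy_inter (h : Set.EqOn (affineEval φ) (affineEval ψ) (A ∩ B)) :
    Prod.fst '' (liftBy φ A ∩ liftBy ψ B) = A ∩ B :=
  Set.Subset.antisymm (Set.image_subset_iff.2 fun _ hp => ⟨hp.1.1, hp.2.1⟩)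
    fun x hx => ⟨(x, affineEval φ x), ⟨⟨hx.1, rfl⟩, hx.2, h hx⟩, rfl⟩

lemma isLift_liftBy (φ : E d × ℝ) (A : Set (E d)) : IsLift A (liftBy φ A) φ.1 := by
  refine ⟨fst_image_liftBy φ A, fun p hp q hq => ?_⟩
  rw [hp.2, hq.2, affineEval, affineEval, inner_sub_right]
  ring

lemma IsLift.eq_liftBy (hL : IsLift A L φ.1) {q : E d × ℝ} (hq : q ∈ L)
    (hqφ : q.2 = affineEval φ q.1) : L = liftBy φ A := by
  have hval : ∀ p ∈ L, p.2 = affineEval φ p.1 := fun p hp => by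
    have hpq := hL.2 p hp q hq
    rw [affineEval] at hqφ ⊢
    rw [inner_sub_right] at hpq
    linarith
  refine Set.Subset.antisymm (fun p hp => ⟨hL.1 ▸ ⟨p, hp, rfl⟩, hval p hp⟩) fun p hp => ?_
  obtain ⟨r, hr, hrp⟩ := hL.1.symm ▸ hp.1
  have hrp' : r = p := Prod.ext hrp (by rw [hval r hr, hp.2, hrp])
  exact hrp' ▸ hr

namespace IsNormalTiling

lemma fst_add_smul_eq (hT : IsNormalTiling T) (hΦ : IsPotentialOn T s Set.univ Φ)
    (h : Adjacent T A B) (hn : IsUnitNormal A B n) : (Φ A).1 + s (A ∩ B) • n = (Φ B).1 := by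
  obtain ⟨w, hw⟩ := h.nonempty
  rw [sub_eq_iff_eq_add'.1 (hΦ.sub_eq_jump h), hT.jump_eq h hn hw, Prod.fst_add]

lemma eq_liftBy_of_genFace (hT : IsNormalTiling T) (hΦ : IsPotentialOn T s Set.univ Φ)
    (hP₀ : P₀ ∈ T) (hΦ₀ : Φ P₀ = 0) (h : GenFace T s P₀ A L v) :
    A ∈ T ∧ L = liftBy (Φ A) A ∧ v = (Φ A).1 := by
  induction h with
  | base => exact ⟨hP₀, by rw [hΦ₀, liftBy_zero], by rw [hΦ₀, Prod.fst_zero]⟩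
  | step _ hAB hn hL' hmeet ih =>
    obtain ⟨-, rfl, rfl⟩ := ih
    have hfst := hT.fst_add_smul_eq hΦ hAB hn
    obtain ⟨w, hw⟩ := hAB.nonempty
    obtain ⟨q, ⟨hqA, hqB⟩, rfl⟩ := hmeet.symm ▸ hw
    refine ⟨hAB.2.1, (hfst ▸ hL').eq_liftBy hqB ?_, hfst⟩
    rw [hqA.2, hT.affineEval_eq_of_mem hΦ hAB.1 hAB.2.1 hw.1 hw.2]

lemma genFace_liftBy (hT : IsNormalTiling T) (hΦ : IsPotentialOn T s Set.univ Φ) (hP₀ : P₀ ∈ T)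
    (hΦ₀ : Φ P₀ = 0) (hA : A ∈ T) : GenFace T s P₀ A (liftBy (Φ A) A) (Φ A).1 := by
  refine hT.forall_of_adjacent_univ (fun B => GenFace T s P₀ B (liftBy (Φ B) B) (Φ B).1)
    (fun B C hBC hB => ?_) hP₀ ?_ hA
  · obtain ⟨n, hn⟩ := hT.exists_isUnitNormal hBC
    have hfst := hT.fst_add_smul_eq hΦ hBC hn
    have hmeet := fst_image_liftBy_inter (φ := Φ B) (ψ := Φ C) fun x hx =>
      (hT.affineEval_eq_of_mem hΦ hBC.1 hBC.2.1 hx.1 hx.2).symm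
    exact hfst ▸ .step hB hBC hn (hfst ▸ isLift_liftBy (Φ C) C) hmeet
  · rw [hΦ₀, liftBy_zero]
    exact .base

end IsNormalTiling

/-- `G` is the piecewise affine function with piece `Φ A` on each tile `A`. -/
def IsLifting (T : Set (Set (E d))) (Φ : Set (E d) → E d × ℝ) (G : E d → ℝ) : Prop :=
  ∀ A ∈ T, Set.EqOn G (affineEval (Φ A)) A

lemma IsNormalTiling.exists_isLifting (hT : IsNormalTiling T)
    (hΦ : IsPotentialOn T s Set.univ Φ) : ∃ G, IsLifting T Φ G := by
  choose t ht hxt using hT.exists_mem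
  exact ⟨fun x => affineEval (Φ (t x)) x, fun A hA x hx =>
    hT.affineEval_eq_of_mem hΦ hA (ht x) hx (hxt x)⟩

lemma IsLifting.generatrix_eq (hG : IsLifting T Φ G) (hT : IsNormalTiling T)
    (hΦ : IsPotentialOn T s Set.univ Φ) (hP₀ : P₀ ∈ T) (hΦ₀ : Φ P₀ = 0) :
    generatrix T s P₀ = {p | p.2 = G p.1} := by
  ext p
  refine ⟨?_, fun hp => ?_⟩
  · rintro ⟨A, L, v, h, hp⟩
    obtain ⟨hA, rfl, rfl⟩ := hT.eq_liftBy_of_genFace hΦ hP₀ hΦ₀ h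
    exact hp.2.trans (hG A hA hp.1).symm
  · obtain ⟨A, hA, hxA⟩ := hT.exists_mem p.1
    exact ⟨A, _, _, hT.genFace_liftBy hΦ hP₀ hΦ₀ hA, hxA, hp.trans (hG A hA hxA)⟩

end Generatrix

section Tangency

variable {d : ℕ} {P P₀ A : Set (E d)} {T : Set (Set (E d))} {s : Set (E d) → ℝ}
  {Φ : Set (E d) → E d × ℝ} {G : E d → ℝ} {Q : Matrix (Fin d) (Fin d) ℝ} {a c n v x : E d}

lemma hasGradientAt_affineEval (φ : E d × ℝ) (x : E d) : HasGradientAt (affineEval φ) φ.1 x :=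
  hasGradientAt_iff_hasFDerivAt.2 (((innerSL ℝ φ.1).hasFDerivAt).add_const φ.2)

lemma IsLifting.hasGradientAt (hG : IsLifting T Φ G) (hA : A ∈ T) (hx : x ∈ interior A) :
    HasGradientAt G (Φ A).1 x := by
  refine (hasGradientAt_affineEval (Φ A) x).congr_of_eventuallyEq ?_
  filter_upwards [isOpen_interior.mem_nhds hx] with y hy using hG A hA (interior_subset hy)

namespace IsTangentParaboloid

lemma smul_unitNormal_eq (hQ : IsTangentParaboloid T Φ P₀ Q c) (hT : IsParallelohedralTiling P T)
    (hΦ : IsPotentialOn T s Set.univ Φ) (hΦ₀ : Φ P₀ = 0) (hc : IsCenter P₀ c)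
    (h : Adjacent T P₀ A) (ha : IsCenter A a) (hn : IsUnitNormal P₀ A n) :
    s (P₀ ∩ A) • n = Matrix.toEuclideanLin Q (a - c) := by
  obtain ⟨v, hv, rfl⟩ := hT.exists_mem_translationGroup_eq_vadd h.1 h.2.1
  obtain rfl := (hT.isCenter_vadd_iff h.1 hc).1 ha
  rw [add_sub_cancel_right, ← hQ.fst_eq v hv, ← hT.isNormalTiling.fst_add_smul_eq hΦ h hn, hΦ₀,
    Prod.fst_zero, zero_add]

lemma lifting_eq (hQ : IsTangentParaboloid T Φ P₀ Q c) (hG : IsLifting T Φ G) (hP₀ : P₀ ∈ T)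
    (hv : v ∈ translationGroup T) (hx : x ∈ v +ᵥ P₀) :
    G x = quadForm Q (x - c) - quadForm Q (x - (v + c)) := by
  rw [hG _ ((vadd_mem_iff hv).2 hP₀) hx, hQ.affineEval_eq v hv]

lemma lifting_le (hQ : IsTangentParaboloid T Φ P₀ Q c) (hT : IsParallelohedralTiling P T)
    (hG : IsLifting T Φ G) (hP₀ : P₀ ∈ T) (x : E d) : G x ≤ quadForm Q (x - c) := by
  obtain ⟨A, hA, hxA⟩ := hT.isNormalTiling.exists_mem x
  obtain ⟨v, hv, rfl⟩ := hT.exists_mem_translationGroup_eq_vadd hP₀ hA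
  rw [hQ.lifting_eq hG hP₀ hv hxA]
  exact sub_le_self _ (quadForm_nonneg hQ.posDef _)

lemma lifting_eq_iff (hQ : IsTangentParaboloid T Φ P₀ Q c) (hT : IsParallelohedralTiling P T)
    (hG : IsLifting T Φ G) (hP₀ : P₀ ∈ T) (hc : IsCenter P₀ c) :
    G x = quadForm Q (x - c) ↔ ∃ A ∈ T, IsCenter A x := by
  have hT' := hT.isNormalTiling
  refine ⟨fun h => ?_, fun ⟨A, hA, hx⟩ => ?_⟩
  · obtain ⟨A, hA, hxA⟩ := hT'.exists_mem x
    obtain ⟨v, hv, rfl⟩ := hT.exists_mem_translationGroup_eq_vadd hP₀ hA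
    rw [hQ.lifting_eq hG hP₀ hv hxA, sub_eq_self] at h
    refine ⟨_, hA, (hT.isCenter_vadd_iff hP₀ hc).2 (sub_eq_zero.1 ?_)⟩
    by_contra hne
    exact (quadForm_pos hQ.posDef hne).ne' h
  · have hxA := interior_subset (hx.mem_interior (hT'.convex hA) (hT'.interior_nonempty hA))
    obtain ⟨v, hv, rfl⟩ := hT.exists_mem_translationGroup_eq_vadd hP₀ hA
    rw [hQ.lifting_eq hG hP₀ hv hxA, (hT.isCenter_vadd_iff hP₀ hc).1 hx, sub_self, quadForm_zero,
      sub_zero]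

lemma hasGradientAt_lifting (hQ : IsTangentParaboloid T Φ P₀ Q c)
    (hT : IsParallelohedralTiling P T) (hG : IsLifting T Φ G) (hP₀ : P₀ ∈ T) (hc : IsCenter P₀ c)
    (hA : A ∈ T) (hx : IsCenter A x) : HasGradientAt G (Matrix.toEuclideanLin Q (x - c)) x := by
  have hT' := hT.isNormalTiling
  have hgrad := hG.hasGradientAt hA (hx.mem_interior (hT'.convex hA) (hT'.interior_nonempty hA))
  obtain ⟨v, hv, rfl⟩ := hT.exists_mem_translationGroup_eq_vadd hP₀ hA
  rwa [hQ.fst_eq v hv, ← add_sub_cancel_right v c, ← (hT.isCenter_vadd_iff hP₀ hc).1 hx] at hgrad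

end IsTangentParaboloid

lemma IsParallelohedralTiling.exists_isCenter (hT : IsParallelohedralTiling P T) (hP₀ : P₀ ∈ T)
    (hc : IsCenter P₀ c) (hA : A ∈ T) : ∃ x, IsCenter A x := by
  obtain ⟨v, -, rfl⟩ := hT.exists_mem_translationGroup_eq_vadd hP₀ hA
  exact ⟨v + c, hc.vadd v⟩

end Tangency

end ParTiling

end

theorem mainTheorem5 (d : ℕ) (P : Set (E d)) (T : Set (Set (E d)))
    (hT : IsParallelohedralTiling P T) (s : Set (E d) → ℝ)
    (hs : IsCanonicalScaling T s) (hinv : IsTranslationInvariant T s)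
    (P₀ : Set (E d)) (hP₀ : P₀ ∈ T) :
    ∃ (c : E d) (Q : Matrix (Fin d) (Fin d) ℝ) (G : E d → ℝ),
      -- `c` is the centre of the initial tile, which the paraboloid has as its vertex
      IsCenter P₀ c ∧
      -- the graph of the form is an elliptic paraboloid
      Q.PosDef ∧
      -- `Q` maps each facet vector to the corresponding scaled facet normal
      (∀ A a n, Adjacent T P₀ A → IsCenter A a → IsUnitNormal P₀ A n →
        s (P₀ ∩ A) • n = Matrix.toEuclideanLin Q (a - c)) ∧
      -- the generatrix is the graph of `G`
      generatrix T s P₀ = {p | p.2 = G p.1} ∧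
      -- the paraboloid is inscribed in the generatrix: it lies in the epigraph of `G`
      (∀ x, G x ≤ quadForm Q (x - c)) ∧
      -- they meet exactly above the centres of the tiles
      (∀ x, G x = quadForm Q (x - c) ↔ ∃ A ∈ T, IsCenter A x) ∧
      -- each tile has a centre, and above it the two surfaces are tangent
      (∀ A ∈ T, ∃ x, IsCenter A x) ∧
      (∀ A ∈ T, ∀ x, IsCenter A x →
        HasGradientAt G (Matrix.toEuclideanLin Q (x - c)) x ∧
        HasGradientAt (fun y => quadForm Q (y - c)) (Matrix.toEuclideanLin Q (x - c)) x) := by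
  have hT' := hT.isNormalTiling
  obtain ⟨Φ, hΦ₀, hΦ⟩ := hT'.exists_isPotentialOn_univ hs hP₀
  obtain ⟨Q, c, hQ⟩ := hT.exists_isTangentParaboloid hs hinv hΦ hP₀ hΦ₀
  obtain ⟨G, hG⟩ := hT'.exists_isLifting hΦ
  have hc : IsCenter P₀ c := hQ.isCenter hT hs hΦ hP₀ hΦ₀
  exact ⟨c, Q, G, hc, hQ.posDef,
    fun A a n hA ha hn => hQ.smul_unitNormal_eq hT hΦ hΦ₀ hc hA ha hn,
    hG.generatrix_eq hT' hΦ hP₀ hΦ₀,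
    hQ.lifting_le hT hG hP₀,
    fun x => hQ.lifting_eq_iff hT hG hP₀ hc,
    fun A hA => hT.exists_isCenter hP₀ hc hA,
    fun A hA x hx => ⟨hQ.hasGradientAt_lifting hT hG hP₀ hc hA hx,
      hasGradientAt_quadForm hQ.posDef.isHermitian c x⟩⟩
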